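/- For $N\ge 2$ let \[ \alpha_N:=\inf\left\{\frac{\sum_{1\le i<j\le N}\frac{|x_i|^2+|x_j|^2}{|x_i-x_j|}}{(N-1)\sum_{i=1}^N|x_i|}\;:\; x_1,\dots,x_N\in\mathbb{R}^3\ \text{pairwise distinct}\right\}, \] and let \[ \beta:=\inf\left\{\frac{\iint_{\mathbb{R}^3\times\mathbb{R}^3}\frac{|x|^2+|y|^2}{2|x-y|}\,d\rho(x)\,d\rho(y)}{\int_{\mathbb{R}^3}|x|\,d\rho(x)}\;:\;\rho\ \text{a Borel probability measure on }\mathbb{R}^3\text{ with } 0<\int_{\mathbb{R}^3}|x|\,d\rho(x)<\infty\right\}, \] where $|\cdot|$ is the Euclidean norm, the double integral takes values in $[0,\infty]$, and its integrand is understood to be $+\infty$ at $x=y\ne 0$ and $0$ at $x=y=0$. Then the sequence $(\alpha_N)_{N\ge 2}$ is increasing in the sense that $\alpha_N\le\alpha_{N+1}$ for all $N\ge 2$, and for every $N\ge 2$ \[ \beta\;\ge\;\alpha_N\;\ge\;\frac{N}{N-1}\left[\beta-3\left(\frac{\beta}{6}\right)^{1/3}N^{-2/3}\right]. \] In particular $\alpha_N\to\beta$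 as $N\to\infty$. Moreover $\beta$ is finite and $\beta\in[0.8218,\,0.8705)$. -/

import Mathlib

open MeasureTheory Filter Topology
open scoped ENNReal

namespace ClassicalParticles

/-- Three-dimensional Euclidean space. -/
abbrev E3 : Type := EuclideanSpace ℝ (Fin 3)

/-- The quotient
`(∑_{i<j} (|x_i|² + |x_j|²) / |x_i - x_j|) / ((N - 1) ∑_i |x_i|)` of an `N`-point configuration. -/
noncomputable def configRatio {N : ℕ} (x : Fin N → E3) : ℝ :=
  (∑ i, ∑ j ∈ Finset.Ioi i, (‖x i‖ ^ 2 + ‖x j‖ ^ 2) / ‖x i - x j‖) /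
    (((N : ℝ) - 1) * ∑ i, ‖x i‖)

/-- `α_N`: the infimum of the quotient over all configurations of `N` distinct points of `ℝ³`
(for `N ≥ 2` all the denominators are then positive). -/
noncomputable def alpha (N : ℕ) : ℝ :=
  sInf {t : ℝ | ∃ x : Fin N → E3, Function.Injective x ∧ t = configRatio x}

/-- The `[0, ∞]`-valued double integral `∬ (|x|² + |y|²) / (2 |x - y|) dρ(x) dρ(y)`.
In `ℝ≥0∞` the integrand is `∞` at `x = y ≠ 0` and is `0` at `x = y = 0`. -/
noncomputable def pairEnergy (ρ : Measure E3) : ℝ≥0∞ :=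
  ∫⁻ x, ∫⁻ y, (‖x‖ₑ ^ 2 + ‖y‖ₑ ^ 2) / (2 * ‖x - y‖ₑ) ∂ρ ∂ρ

/-- The first moment `∫ |x| dρ(x)`, with values in `[0, ∞]`. -/
noncomputable def firstMoment (ρ : Measure E3) : ℝ≥0∞ :=
  ∫⁻ x, ‖x‖ₑ ∂ρ

/-- `β` as an infimum in `[0, ∞]`, over all Borel probability measures on `ℝ³` for which the
denominator is positive and finite. -/
noncomputable def betaENN : ℝ≥0∞ :=
  sInf {q : ℝ≥0∞ | ∃ ρ : Measure E3, IsProbabilityMeasure ρ ∧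
    firstMoment ρ ≠ 0 ∧ firstMoment ρ ≠ ∞ ∧ q = pairEnergy ρ / firstMoment ρ}

/-- `β` as a real number. -/
noncomputable def beta : ℝ := betaENN.toReal

end ClassicalParticles

/-!
The sequence `α_N` is increasing because the numerator and the denominator for `N + 1` points are,
up to explicit factors, the averages of those of the `N + 1` configurations of `N` points obtained
by leaving one point out (`alpha_le_succ`).

For `α_N ≤ β`, the inequality defining `α_N` is integrated against `ρ^{⊗N}`
(`ofReal_alpha_mul_firstMoment_le`). A measure with an atom away from the origin has infinite
energy; an atom at the origin leads to configurations in which several points sit at `0`, and these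
are limits of configurations of distinct points (`alpha_mul_le_of_degenerate`).

For the lower bound on `α_N`, given points `x_i`, the trial measure for `β` is the average of
Gaussians with means `x_i` and standard deviations `t |x_i|`. Smearing does not decrease the first
moment, and it makes the self-energies finite, of order `|x_i| / t`. For the interaction of two
points, `1 / |u|` is written as a time integral of the heat kernel; a Gaussian times a heat kernel
is again Gaussian, and after adding a total derivative in the time `θ` the integrand becomes, for
large `θ`, `(1 + 2 t²) (|a|² + |z|²)` plus the nonpositive error `-t² (|a|² - |z|²)² / θ`
(`lintegral_gauss_norm_sq_mul_inv_eq`, `smear_pair_pointwise`). So smearing costs only a factor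
`1 + 2 t²` (`smear_pair_le`), and with `r³ = β N / 6` the choice `t = (4 π r²)^{-1/2}` gives the
bound, by `π ≥ 3` (`sub_mul_le_pairSum`).

For `β ≥ 0.8218`, write `S = |x|² + |y|²` and `t = 2 x·y / S`, so that the interaction is
`√S (1 - t)^{-1/2}`. A quartic polynomial with nonnegative coefficients minorizes `(1 - t)^{-1/2}`
(`minorant_le`). The kernels `(x·y)^n S^{1/2 - n}` with `n ≥ 1` are positive definite, since
`S^{1/2 - n}` is a Laplace transform (`powKernel_posDef`). The odd ones can be dropped, and the
even ones remain nonnegative after subtraction of the spherical average. This leaves a function of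
`|x|` and `|y|` that is at least `0.8218 (|x| + |y|)` (`radial_part_ge`). Summing over the pairs of
`N` points bounds `α_N` up to a diagonal term that is negligible as `N → ∞` (`le_pairSum`), and
`α_N ≤ β` concludes.

For `β < 0.8705`, the trial measure is a mixture of uniform measures on 32 spheres, whose energy is
a rational number by Newton's theorem (`lintegral_sphereMeasure_inv`, `shell_energy_lt`).
-/

namespace ClassicalParticles

/-! ### Configurations of distinct points -/

/-- The interaction `(|x|² + |y|²) / |x - y|` of two points; it vanishes on the diagonal. -/
noncomputable def pairTerm (x y : E3) : ℝ := (‖x‖ ^ 2 + ‖y‖ ^ 2) / ‖x - y‖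

lemma pairTerm_self (x : E3) : pairTerm x x = 0 := by simp [pairTerm]

lemma pairTerm_comm (x y : E3) : pairTerm x y = pairTerm y x := by
  simp [pairTerm, norm_sub_rev x y, add_comm]

lemma pairTerm_nonneg (x y : E3) : 0 ≤ pairTerm x y := by unfold pairTerm; positivity

/-- The sum of `pairTerm` over all ordered pairs of points, twice the numerator of
`configRatio`. -/
noncomputable def pairSum {N : ℕ} (x : Fin N → E3) : ℝ := ∑ i, ∑ j, pairTerm (x i) (x j)

lemma pairSum_nonneg {N : ℕ} (x : Fin N → E3) : 0 ≤ pairSum x :=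
  Finset.sum_nonneg fun _ _ => Finset.sum_nonneg fun _ _ => pairTerm_nonneg _ _

lemma sum_sum_eq_two_mul_sum_Ioi {N : ℕ} (f : Fin N → Fin N → ℝ) (h0 : ∀ i, f i i = 0)
    (hs : ∀ i j, f i j = f j i) :
    ∑ i, ∑ j, f i j = 2 * ∑ i, ∑ j ∈ Finset.Ioi i, f i j := by
  have h1 : ∀ i, ∑ j, f i j = ∑ j ∈ Finset.Ioi i, f i j + ∑ j ∈ Finset.Iio i, f i j := by
    intro i
    have hu : (Finset.univ : Finset (Fin N)) = insert i (Finset.Ioi i ∪ Finset.Iio i) := by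
      ext j
      simp only [Finset.mem_univ, Finset.mem_insert, Finset.mem_union, Finset.mem_Ioi,
        Finset.mem_Iio, true_iff]
      rcases lt_trichotomy i j with h | h | h
      · exact Or.inr (Or.inl h)
      · exact Or.inl h.symm
      · exact Or.inr (Or.inr h)
    rw [hu, Finset.sum_insert (by simp), h0, zero_add, Finset.sum_union]
    rw [Finset.disjoint_left]
    intro j hj hj'
    exact absurd (Finset.mem_Ioi.1 hj) (not_lt.2 (Finset.mem_Iio.1 hj').le)
  simp_rw [h1, Finset.sum_add_distrib]
  have h2 : ∑ i, ∑ j ∈ Finset.Iio i, f i j = ∑ i, ∑ j ∈ Finset.Ioi i, f i j := by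
    rw [Finset.sum_comm' (t' := Finset.univ) (s' := fun j => Finset.Ioi j) (by simp)]
    exact Finset.sum_congr rfl fun i _ => Finset.sum_congr rfl fun j _ => hs j i
  rw [h2]; ring

lemma configRatio_eq {N : ℕ} (x : Fin N → E3) :
    configRatio x = pairSum x / (2 * (((N : ℝ) - 1) * ∑ i, ‖x i‖)) := by
  have h := sum_sum_eq_two_mul_sum_Ioi (fun i j => pairTerm (x i) (x j))
    (fun i => pairTerm_self _) (fun i j => pairTerm_comm _ _)
  rw [pairSum, h, mul_div_mul_left _ _ two_ne_zero]
  rfl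

lemma configRatio_nonneg {N : ℕ} (hN : 1 ≤ N) (x : Fin N → E3) : 0 ≤ configRatio x := by
  rw [configRatio_eq]
  have : (1 : ℝ) ≤ N := by exact_mod_cast hN
  have h1 : (0 : ℝ) ≤ (N : ℝ) - 1 := by linarith
  exact div_nonneg (pairSum_nonneg x)
    (mul_nonneg zero_le_two (mul_nonneg h1 (Finset.sum_nonneg fun _ _ => norm_nonneg _)))

lemma sum_norm_pos {N : ℕ} (hN : 2 ≤ N) {x : Fin N → E3} (hx : Function.Injective x) :
    0 < ∑ i, ‖x i‖ := by
  refine (Finset.sum_nonneg fun _ _ => norm_nonneg _).lt_of_ne fun h => ?_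
  have h0 := (Finset.sum_eq_zero_iff_of_nonneg fun i _ => norm_nonneg (x i)).1 h.symm
  have h1 : x ⟨0, by omega⟩ = x ⟨1, by omega⟩ := by
    rw [norm_eq_zero.1 (h0 _ (Finset.mem_univ _)), norm_eq_zero.1 (h0 _ (Finset.mem_univ _))]
  simpa using hx h1

lemma alpha_le_configRatio {N : ℕ} (hN : 1 ≤ N) {x : Fin N → E3} (hx : Function.Injective x) :
    alpha N ≤ configRatio x :=
  csInf_le ⟨0, by rintro _ ⟨y, -, rfl⟩; exact configRatio_nonneg hN y⟩ ⟨x, hx, rfl⟩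

lemma alpha_nonneg {N : ℕ} (hN : 1 ≤ N) : 0 ≤ alpha N := by
  apply Real.sInf_nonneg
  rintro _ ⟨y, -, rfl⟩
  exact configRatio_nonneg hN y

lemma alpha_mul_le {N : ℕ} (hN : 2 ≤ N) {x : Fin N → E3} (hx : Function.Injective x) :
    2 * (alpha N * (((N : ℝ) - 1) * ∑ i, ‖x i‖)) ≤ pairSum x := by
  have h := alpha_le_configRatio (by omega) hx
  have : (2 : ℝ) ≤ N := by exact_mod_cast hN
  have hs := sum_norm_pos hN hx
  have h1 : (0 : ℝ) < (N : ℝ) - 1 := by linarith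
  rw [configRatio_eq, le_div_iff₀ (by positivity)] at h
  linarith

lemma exists_injective_config (N : ℕ) :
    ∃ v : Fin N → E3, Function.Injective v ∧ ∀ i, v i ≠ 0 := by
  refine ⟨fun i => EuclideanSpace.single 0 ((i : ℝ) + 1), fun i j h => ?_, fun i h => ?_⟩
  · have := congrArg (fun w : E3 => w 0) h
    simpa [Fin.ext_iff] using this
  · have := congrArg (fun w : E3 => w 0) h
    simp only [PiLp.single_apply, if_true, PiLp.zero_apply] at this
    have h2 : (0 : ℝ) ≤ (i : ℝ) := Nat.cast_nonneg _
    linarith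

lemma le_alpha {N : ℕ} (hN : 2 ≤ N) {c : ℝ} (h : ∀ x : Fin N → E3, Function.Injective x →
    2 * (c * (((N : ℝ) - 1) * ∑ i, ‖x i‖)) ≤ pairSum x) : c ≤ alpha N := by
  obtain ⟨v, hv, -⟩ := exists_injective_config N
  refine le_csInf ⟨_, v, hv, rfl⟩ ?_
  rintro _ ⟨x, hx, rfl⟩
  have : (2 : ℝ) ≤ N := by exact_mod_cast hN
  have hs := sum_norm_pos hN hx
  have h1 : (0 : ℝ) < (N : ℝ) - 1 := by linarith
  rw [configRatio_eq, le_div_iff₀ (by positivity)]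
  linarith [h x hx]

/-- Each pair of points survives in `N - 1` of the `N + 1` configurations obtained by leaving
one point out. -/
lemma sum_pairSum_succAbove {N : ℕ} (x : Fin (N + 1) → E3) :
    ∑ k, pairSum (fun i => x (Fin.succAbove k i)) = ((N : ℝ) - 1) * pairSum x := by
  have h : ∀ k : Fin (N + 1), pairSum (fun i => x (Fin.succAbove k i)) =
      pairSum x - 2 * ∑ j, pairTerm (x k) (x j) := by
    intro k
    have e1 : pairSum x = ∑ j, pairTerm (x k) (x j) +
        ∑ i, (pairTerm (x (Fin.succAbove k i)) (x k) +
          ∑ j, pairTerm (x (Fin.succAbove k i)) (x (Fin.succAbove k j))) := by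
      rw [pairSum, Fin.sum_univ_succAbove _ k]
      congr 1
      exact Finset.sum_congr rfl fun i _ => Fin.sum_univ_succAbove _ k
    have e2 : ∑ j, pairTerm (x k) (x j) = ∑ i, pairTerm (x (Fin.succAbove k i)) (x k) := by
      rw [Fin.sum_univ_succAbove _ k, pairTerm_self, zero_add]
      exact Finset.sum_congr rfl fun i _ => pairTerm_comm _ _
    rw [Finset.sum_add_distrib, ← e2] at e1
    rw [e1, pairSum]; ring
  simp_rw [h]
  rw [Finset.sum_sub_distrib, ← Finset.mul_sum]
  change _ - 2 * pairSum x = _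
  simp
  ring

lemma sum_sum_norm_succAbove {N : ℕ} (x : Fin (N + 1) → E3) :
    ∑ k, ∑ i, ‖x (Fin.succAbove k i)‖ = (N : ℝ) * ∑ i, ‖x i‖ := by
  have h : ∀ k : Fin (N + 1), ∑ i, ‖x (Fin.succAbove k i)‖ = ∑ i, ‖x i‖ - ‖x k‖ := by
    intro k
    rw [Fin.sum_univ_succAbove (fun i => ‖x i‖) k]; ring
  simp_rw [h]
  rw [Finset.sum_sub_distrib]
  simp
  ring

lemma alpha_le_succ {N : ℕ} (hN : 2 ≤ N) : alpha N ≤ alpha (N + 1) := by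
  refine le_alpha (by omega) fun x hx => ?_
  have h2 : (2 : ℝ) ≤ N := by exact_mod_cast hN
  have h1 : (0 : ℝ) < (N : ℝ) - 1 := by linarith
  have h : ∑ k, 2 * (alpha N * (((N : ℝ) - 1) * ∑ i, ‖x (Fin.succAbove k i)‖)) ≤
      ∑ k, pairSum (fun i => x (Fin.succAbove k i)) :=
    Finset.sum_le_sum fun k _ =>
      alpha_mul_le hN (hx.comp Fin.succAbove_right_injective)
  rw [sum_pairSum_succAbove, ← Finset.mul_sum, ← Finset.mul_sum, ← Finset.mul_sum,
    sum_sum_norm_succAbove] at h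
  refine le_of_mul_le_mul_left (le_trans (le_of_eq ?_) h) h1
  push_cast; ring

theorem alpha_monotoneOn : MonotoneOn alpha (Set.Ici 2) := by
  intro M hM N _ hMN
  induction N, hMN using Nat.le_induction with
  | base => exact le_rfl
  | succ n hn ih => exact (ih (le_trans hM hn)).trans (alpha_le_succ (le_trans hM hn))

/-! ### The discrete infima are at most the continuous one -/

lemma pairTerm_smul {c : ℝ} (hc : 0 < c) (x y : E3) :
    pairTerm (c • x) (c • y) = c * pairTerm x y := by
  unfold pairTerm
  rw [← smul_sub, norm_smul, norm_smul, norm_smul, Real.norm_of_nonneg hc.le]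
  rcases eq_or_ne ‖x - y‖ 0 with h | h
  · simp [h]
  · field_simp

/-- The inequality defining `alpha` persists for configurations in which several points sit
at the origin: these can be pulled apart at vanishing cost. -/
lemma alpha_mul_le_of_degenerate {N : ℕ} (hN : 2 ≤ N) {x : Fin N → E3}
    (hx : ∀ i j, i ≠ j → x i = x j → x i = 0) :
    2 * (alpha N * (((N : ℝ) - 1) * ∑ i, ‖x i‖)) ≤ pairSum x := by
  obtain ⟨v, hv, -⟩ := exists_injective_config N
  set w : Fin N → E3 := fun i => if x i = 0 then v i else 0 with hw
  set y : ℝ → Fin N → E3 := fun ε i => x i + ε • w i with hy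
  have hlim : ∀ i, Tendsto (fun ε => y ε i) (𝓝[>] 0) (𝓝 (x i)) := by
    intro i
    have : ContinuousAt (fun ε : ℝ => y ε i) 0 := by
      simp only [hy]; fun_prop
    have h := this.tendsto.mono_left (nhdsWithin_le_nhds (s := Set.Ioi 0))
    simpa [hy] using h
  have hpos : ∀ᶠ ε : ℝ in 𝓝[>] 0, 0 < ε := self_mem_nhdsWithin
  have hinj : ∀ᶠ ε in 𝓝[>] (0 : ℝ), Function.Injective (y ε) := by
    have : ∀ᶠ ε in 𝓝[>] (0 : ℝ), ∀ i j, i ≠ j → y ε i ≠ y ε j := by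
      rw [eventually_all]; intro i
      rw [eventually_all]; intro j
      by_cases hij : i = j
      · simp [hij]
      by_cases hxe : x i = x j
      · have h0 := hx i j hij hxe
        have h0' : x j = 0 := hxe ▸ h0
        filter_upwards [hpos] with ε hε _ h
        simp only [hy, hw, h0, h0', if_true, zero_add] at h
        exact hij (hv (smul_right_injective E3 hε.ne' h))
      · filter_upwards [((hlim i).sub (hlim j)).eventually_ne (sub_ne_zero.2 hxe)] with ε hε _ h
        exact hε (sub_eq_zero.2 h)
    filter_upwards [this] with ε hε i j h
    by_contra hij
    exact hε i j hij h
  have hterm : ∀ i j, Tendsto (fun ε => pairTerm (y ε i) (y ε j)) (𝓝[>] 0)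
      (𝓝 (pairTerm (x i) (x j))) := by
    intro i j
    by_cases hij : i = j
    · subst hij; simp only [pairTerm_self]; exact tendsto_const_nhds
    by_cases hxe : x i = x j
    · have h0 := hx i j hij hxe
      have h0' : x j = 0 := hxe ▸ h0
      have h1 : Tendsto (fun ε : ℝ => ε * pairTerm (v i) (v j)) (𝓝[>] 0)
          (𝓝 (0 * pairTerm (v i) (v j))) :=
        (tendsto_id.mono_left nhdsWithin_le_nhds).mul_const _
      rw [zero_mul] at h1
      rw [hxe, pairTerm_self]
      refine h1.congr' ?_
      filter_upwards [hpos] with ε hε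
      simp only [hy, hw, h0, h0', if_true, zero_add]
      exact (pairTerm_smul hε _ _).symm
    · unfold pairTerm
      exact (((hlim i).norm.pow 2).add ((hlim j).norm.pow 2)).div ((hlim i).sub (hlim j)).norm
        (norm_ne_zero_iff.2 (sub_ne_zero.2 hxe))
  have hR : Tendsto (fun ε => pairSum (y ε)) (𝓝[>] 0) (𝓝 (pairSum x)) :=
    tendsto_finsetSum _ fun i _ => tendsto_finsetSum _ fun j _ => hterm i j
  have hL : Tendsto (fun ε => 2 * (alpha N * (((N : ℝ) - 1) * ∑ i, ‖y ε i‖))) (𝓝[>] 0)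
      (𝓝 (2 * (alpha N * (((N : ℝ) - 1) * ∑ i, ‖x i‖)))) :=
    (((tendsto_finsetSum _ fun i _ => (hlim i).norm).const_mul _).const_mul _).const_mul _
  exact le_of_tendsto_of_tendsto hL hR (hinj.mono fun ε hε => alpha_mul_le hN hε)

/-- The integrand of `pairEnergy`. -/
noncomputable def pairKernel (x y : E3) : ℝ≥0∞ := (‖x‖ₑ ^ 2 + ‖y‖ₑ ^ 2) / (2 * ‖x - y‖ₑ)

lemma measurable_pairKernel : Measurable fun p : E3 × E3 => pairKernel p.1 p.2 := by
  unfold pairKernel; fun_prop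

lemma pairKernel_of_ne {x y : E3} (h : x ≠ y) :
    pairKernel x y = ENNReal.ofReal (pairTerm x y / 2) := by
  have h1 : 0 < ‖x - y‖ := norm_pos_iff.2 (sub_ne_zero.2 h)
  unfold pairKernel pairTerm
  rw [div_div, mul_comm ‖x - y‖ 2, ENNReal.ofReal_div_of_pos (by positivity),
    ENNReal.ofReal_add (by positivity) (by positivity), ENNReal.ofReal_pow (norm_nonneg _),
    ENNReal.ofReal_pow (norm_nonneg _), ENNReal.ofReal_mul zero_le_two, ofReal_norm, ofReal_norm,
    ofReal_norm, ENNReal.ofReal_ofNat]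

lemma pairKernel_self {x : E3} (h : x ≠ 0) : pairKernel x x = ∞ := by
  unfold pairKernel
  rw [sub_self, enorm_zero, mul_zero, ENNReal.div_zero]
  have : ‖x‖ₑ ≠ 0 := by simpa using h
  simp [this]

/-- The inequality defining `alpha` for arbitrary configurations: where two points coincide away
from the origin, the right-hand side is infinite. -/
lemma ofReal_alpha_mul_le {N : ℕ} (hN : 2 ≤ N) (x : Fin N → E3) :
    ENNReal.ofReal (alpha N) * (((N - 1 : ℕ) : ℝ≥0∞) * ∑ i, ‖x i‖ₑ) ≤
      ∑ i, ∑ j ∈ Finset.univ.erase i, pairKernel (x i) (x j) := by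
  by_cases hx : ∀ i j, i ≠ j → x i = x j → x i = 0
  · have h := alpha_mul_le_of_degenerate hN hx
    have hk : ∀ i j, i ≠ j → pairKernel (x i) (x j) =
        ENNReal.ofReal (pairTerm (x i) (x j) / 2) := by
      intro i j hij
      by_cases hxe : x i = x j
      · have h0 := hx i j hij hxe
        have h0' : x j = 0 := hxe ▸ h0
        simp [h0, h0', pairTerm_self, pairKernel]
      · exact pairKernel_of_ne hxe
    have h2 : ∑ i, ∑ j ∈ Finset.univ.erase i, pairKernel (x i) (x j) =
        ENNReal.ofReal (pairSum x / 2) := by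
      unfold pairSum
      rw [Finset.sum_div, ENNReal.ofReal_sum_of_nonneg
        fun i _ => div_nonneg (Finset.sum_nonneg fun _ _ => pairTerm_nonneg _ _) zero_le_two]
      refine Finset.sum_congr rfl fun i _ => ?_
      rw [← Finset.add_sum_erase _ _ (Finset.mem_univ i), pairTerm_self, zero_add,
        Finset.sum_div, ENNReal.ofReal_sum_of_nonneg
        fun i _ => div_nonneg (pairTerm_nonneg _ _) zero_le_two]
      exact Finset.sum_congr rfl fun j hj => hk i j (Finset.ne_of_mem_erase hj).symm
    have h3 : ENNReal.ofReal (alpha N) * (((N - 1 : ℕ) : ℝ≥0∞) * ∑ i, ‖x i‖ₑ) =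
        ENNReal.ofReal (alpha N * (((N : ℝ) - 1) * ∑ i, ‖x i‖)) := by
      rw [ENNReal.ofReal_mul (alpha_nonneg (by omega)), ← Nat.cast_pred (by omega),
        ENNReal.ofReal_mul (Nat.cast_nonneg _), ENNReal.ofReal_natCast,
        ENNReal.ofReal_sum_of_nonneg fun _ _ => norm_nonneg _]
      simp only [ofReal_norm]
    rw [h2, h3]
    exact ENNReal.ofReal_le_ofReal (by linarith)
  · push Not at hx
    obtain ⟨i, j, hij, hxe, h0⟩ := hx
    have : pairKernel (x i) (x j) = ∞ := hxe ▸ pairKernel_self h0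
    have h1 : ∑ j ∈ Finset.univ.erase i, pairKernel (x i) (x j) = ∞ :=
      ENNReal.sum_eq_top.2 ⟨j, by simp [Ne.symm hij], this⟩
    have h2 : ∑ i, ∑ j ∈ Finset.univ.erase i, pairKernel (x i) (x j) = ∞ :=
      ENNReal.sum_eq_top.2 ⟨i, Finset.mem_univ _, h1⟩
    rw [h2]; exact le_top

lemma lintegral_pi_enorm (N : ℕ) (ρ : Measure E3) [IsProbabilityMeasure ρ] (i : Fin N) :
    ∫⁻ x, ‖x i‖ₑ ∂(Measure.pi fun _ : Fin N => ρ) = firstMoment ρ :=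
  (measurePreserving_eval (fun _ : Fin N => ρ) i).lintegral_comp (f := fun x : E3 => ‖x‖ₑ)
    (by fun_prop)

lemma lintegral_pi_pairKernel (N : ℕ) (ρ : Measure E3) [IsProbabilityMeasure ρ] {i j : Fin N}
    (hij : i ≠ j) :
    ∫⁻ x, pairKernel (x i) (x j) ∂(Measure.pi fun _ : Fin N => ρ) = pairEnergy ρ := by
  have hind : ProbabilityTheory.iIndepFun (fun i (x : Fin N → E3) => x i)
      (Measure.pi fun _ : Fin N => ρ) :=
    ProbabilityTheory.iIndepFun_pi (X := fun _ => id) (fun _ => aemeasurable_id)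
  have hm := (ProbabilityTheory.indepFun_iff_map_prod_eq_prod_map_map
    (measurable_pi_apply i).aemeasurable (measurable_pi_apply j).aemeasurable).1
    (hind.indepFun hij)
  have e : ∀ i : Fin N, Measure.map (fun x : Fin N → E3 => x i)
      (Measure.pi fun _ : Fin N => ρ) = ρ := fun i =>
    (measurePreserving_eval (fun _ : Fin N => ρ) i).map_eq
  rw [e, e] at hm
  have := lintegral_map (μ := Measure.pi fun _ : Fin N => ρ) measurable_pairKernel
    ((measurable_pi_apply i).prodMk (measurable_pi_apply j))
  rw [hm, lintegral_prod _ measurable_pairKernel.aemeasurable] at this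
  exact this.symm

/-- Integrating the inequality for `N` points against `ρ^{⊗N}`. -/
lemma ofReal_alpha_mul_firstMoment_le {N : ℕ} (hN : 2 ≤ N) (ρ : Measure E3)
    [IsProbabilityMeasure ρ] :
    ENNReal.ofReal (alpha N) * firstMoment ρ ≤ pairEnergy ρ := by
  have hmk : ∀ i j : Fin N, Measurable fun x : Fin N → E3 => pairKernel (x i) (x j) :=
    fun i j => by unfold pairKernel; fun_prop
  have hL : ∫⁻ x, ENNReal.ofReal (alpha N) * (((N - 1 : ℕ) : ℝ≥0∞) * ∑ i, ‖x i‖ₑ)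
      ∂(Measure.pi fun _ : Fin N => ρ) =
      ENNReal.ofReal (alpha N) * (((N - 1 : ℕ) : ℝ≥0∞) * (N * firstMoment ρ)) := by
    rw [lintegral_const_mul _ (by fun_prop), lintegral_const_mul _ (by fun_prop),
      lintegral_finsetSum _ (by fun_prop)]
    simp_rw [lintegral_pi_enorm]
    simp
  have hR : ∫⁻ x, ∑ i, ∑ j ∈ Finset.univ.erase i, pairKernel (x i) (x j)
      ∂(Measure.pi fun _ : Fin N => ρ) = N * (((N - 1 : ℕ) : ℝ≥0∞) * pairEnergy ρ) := by
    rw [lintegral_finsetSum _ (fun i _ => Finset.measurable_fun_sum _ fun j _ => hmk i j)]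
    have : ∀ i : Fin N, ∫⁻ x, ∑ j ∈ Finset.univ.erase i, pairKernel (x i) (x j)
        ∂(Measure.pi fun _ : Fin N => ρ) = ((N - 1 : ℕ) : ℝ≥0∞) * pairEnergy ρ := by
      intro i
      rw [lintegral_finsetSum _ (fun j _ => hmk i j),
        Finset.sum_congr rfl fun j hj =>
          lintegral_pi_pairKernel N ρ (Finset.ne_of_mem_erase hj).symm]
      simp [Finset.card_erase_of_mem]
    rw [Finset.sum_congr rfl fun i _ => this i]
    simp
  have h := lintegral_mono (μ := Measure.pi fun _ : Fin N => ρ)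
    fun x => ofReal_alpha_mul_le hN x
  rw [hL, hR] at h
  have hne : ((N : ℝ≥0∞) * ((N - 1 : ℕ) : ℝ≥0∞)) ≠ 0 :=
    mul_ne_zero (Nat.cast_ne_zero.2 (by omega)) (Nat.cast_ne_zero.2 (by omega))
  have hnt : ((N : ℝ≥0∞) * ((N - 1 : ℕ) : ℝ≥0∞)) ≠ ∞ :=
    ENNReal.mul_ne_top (ENNReal.natCast_ne_top _) (ENNReal.natCast_ne_top _)
  rw [← ENNReal.mul_le_mul_iff_right hne hnt]
  calc _ = ENNReal.ofReal (alpha N) * (((N - 1 : ℕ) : ℝ≥0∞) * (N * firstMoment ρ)) := by ring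
    _ ≤ _ := h
    _ = _ := by ring

theorem ofReal_alpha_le_betaENN {N : ℕ} (hN : 2 ≤ N) : ENNReal.ofReal (alpha N) ≤ betaENN := by
  refine le_sInf ?_
  rintro _ ⟨ρ, hρ, h0, ht, rfl⟩
  rw [ENNReal.le_div_iff_mul_le (Or.inl h0) (Or.inl ht)]
  exact ofReal_alpha_mul_firstMoment_le hN ρ

theorem alpha_le_beta {N : ℕ} (hN : 2 ≤ N) (hβ : betaENN ≠ ∞) : alpha N ≤ beta :=
  (ENNReal.ofReal_le_iff_le_toReal hβ).1 (ofReal_alpha_le_betaENN hN)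

/-! ### Positive definite kernels and the lower bound on `β` -/

/-- `S^{1/2 - n}` for `S = a + b`; for `n ≥ 1` it is a positive definite kernel in `a, b > 0`,
being a Laplace transform of a positive function evaluated at `a + b`. -/
noncomputable def powKernel (n : ℕ) (S : ℝ) : ℝ := √S / S ^ n

lemma powKernel_eq_integral {n : ℕ} (hn : 1 ≤ n) {S : ℝ} (hS : 0 < S) :
    powKernel n S = (Real.Gamma ((n : ℝ) - 1 / 2))⁻¹ *
      ∫ u in Set.Ioi (0 : ℝ), u ^ ((n : ℝ) - 1 / 2 - 1) * Real.exp (-(S * u)) := by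
  have hn' : (1 : ℝ) ≤ n := by exact_mod_cast hn
  have hq : (0 : ℝ) < (n : ℝ) - 1 / 2 := by linarith
  rw [Real.integral_rpow_mul_exp_neg_mul_Ioi hq hS, one_div S, Real.inv_rpow hS.le,
    ← Real.rpow_neg hS.le, mul_comm _ (Real.Gamma _), ← mul_assoc,
    inv_mul_cancel₀ (Real.Gamma_pos_of_pos hq).ne', one_mul, powKernel, Real.sqrt_eq_rpow,
    ← Real.rpow_natCast, ← Real.rpow_sub hS]
  congr 1; ring

lemma powKernel_posDef_of_pos {ι : Type*} (s : Finset ι) {n : ℕ} (hn : 1 ≤ n) (f a : ι → ℝ)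
    (ha : ∀ i, 0 < a i) :
    0 ≤ ∑ i ∈ s, ∑ j ∈ s, f i * f j * powKernel n (a i + a j) := by
  have hn' : (1 : ℝ) ≤ n := by exact_mod_cast hn
  have hq : (0 : ℝ) < (n : ℝ) - 1 / 2 := by linarith
  have hint : ∀ S : ℝ, 0 < S → IntegrableOn
      (fun u : ℝ => u ^ ((n : ℝ) - 1 / 2 - 1) * Real.exp (-(S * u))) (Set.Ioi 0) := by
    intro S hS
    have h := integrableOn_rpow_mul_exp_neg_mul_rpow (s := (n : ℝ) - 1 / 2 - 1) (p := 1) (b := S)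
      (by linarith) one_pos hS
    simpa using h
  have e : ∑ i ∈ s, ∑ j ∈ s, f i * f j * powKernel n (a i + a j) =
      (Real.Gamma ((n : ℝ) - 1 / 2))⁻¹ * ∫ u in Set.Ioi (0 : ℝ),
        u ^ ((n : ℝ) - 1 / 2 - 1) * (∑ i ∈ s, f i * Real.exp (-(a i * u))) ^ 2 := by
    have h1 : ∀ u : ℝ, u ^ ((n : ℝ) - 1 / 2 - 1) * (∑ i ∈ s, f i * Real.exp (-(a i * u))) ^ 2 =
        ∑ i ∈ s, ∑ j ∈ s, f i * f j *
          (u ^ ((n : ℝ) - 1 / 2 - 1) * Real.exp (-((a i + a j) * u))) := by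
      intro u
      rw [sq, Finset.sum_mul_sum, Finset.mul_sum]
      refine Finset.sum_congr rfl fun i _ => ?_
      rw [Finset.mul_sum]
      refine Finset.sum_congr rfl fun j _ => ?_
      rw [show -((a i + a j) * u) = -(a i * u) + -(a j * u) by ring, Real.exp_add]
      ring
    simp_rw [h1]
    rw [integral_finsetSum _ fun i _ => integrable_finsetSum _ fun j _ =>
      (hint _ (add_pos (ha i) (ha j))).const_mul _, Finset.mul_sum]
    refine Finset.sum_congr rfl fun i _ => ?_
    rw [integral_finsetSum _ fun j _ =>
      (hint _ (add_pos (ha i) (ha j))).const_mul _, Finset.mul_sum]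
    refine Finset.sum_congr rfl fun j _ => ?_
    rw [integral_const_mul, powKernel_eq_integral hn (add_pos (ha i) (ha j))]
    ring
  rw [e]
  refine mul_nonneg (inv_nonneg.2 (Real.Gamma_pos_of_pos hq).le) ?_
  refine setIntegral_nonneg measurableSet_Ioi fun u hu => ?_
  exact mul_nonneg (Real.rpow_nonneg (le_of_lt hu) _) (sq_nonneg _)

lemma powKernel_posDef {ι : Type*} (s : Finset ι) {n : ℕ} (hn : 1 ≤ n) (f a : ι → ℝ)
    (ha : ∀ i, 0 ≤ a i) (h0 : ∀ i, a i = 0 → f i = 0) :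
    0 ≤ ∑ i ∈ s, ∑ j ∈ s, f i * f j * powKernel n (a i + a j) := by
  have h := powKernel_posDef_of_pos s hn f (fun i => if a i = 0 then 1 else a i) (fun i => by
    split_ifs with h
    · exact one_pos
    · exact lt_of_le_of_ne (ha i) (Ne.symm h))
  refine le_of_le_of_eq h (Finset.sum_congr rfl fun i _ => Finset.sum_congr rfl fun j _ => ?_)
  by_cases hi : a i = 0
  · simp [h0 i hi]
  by_cases hj : a j = 0
  · simp [h0 j hj]
  simp [hi, hj]

/-- The scalar product in coordinates. -/
def dot (x y : E3) : ℝ := x 0 * y 0 + x 1 * y 1 + x 2 * y 2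

lemma norm_sq_eq_coord (x : E3) : ‖x‖ ^ 2 = x 0 ^ 2 + x 1 ^ 2 + x 2 ^ 2 := by
  rw [EuclideanSpace.norm_sq_eq, Fin.sum_univ_three]; simp

lemma norm_sub_sq_eq_dot (x y : E3) : ‖x - y‖ ^ 2 = ‖x‖ ^ 2 + ‖y‖ ^ 2 - 2 * dot x y := by
  simp only [norm_sq_eq_coord, dot, PiLp.sub_apply]; ring

/-- A polynomial minorant of `(1 - t)^{-1/2}` on `[-1, 1)`, written with `t = 1 - w²`. Up to
rounding it is the quartic Hermite interpolant at the double nodes `w = 5/7, 8/7` and the simple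
node `w = 10/7`. -/
lemma minorant_le {w : ℝ} (h0 : 0 ≤ w) (h1 : w ^ 2 ≤ 2) :
    w * (0.9939 + 0.474 * (1 - w ^ 2) + 0.4078 * (1 - w ^ 2) ^ 2 + 0.5085 * (1 - w ^ 2) ^ 3
      + 0.282 * (1 - w ^ 2) ^ 4) ≤ 1 := by
  have hw : w ≤ 10 / 7 := by nlinarith
  have hQ : 0 ≤ (10 / 7 - w) * ((w - 8 / 7) ^ 2 * (w - 5 / 7) ^ 2) *
      (16807/16000 + 5563889567369/2050064640000 * w + 19767066974753/6833548800000 * w ^ 2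
        + 825848096857/569462400000 * w ^ 3 + 5780936677999/20500646400000 * w ^ 4) :=
    mul_nonneg (mul_nonneg (by linarith) (by positivity)) (by positivity)
  -- the exact interpolant, whose error vanishes at the nodes; its rounding is dealt with below
  have hI : (10 / 7 - w) * ((w - 8 / 7) ^ 2 * (w - 5 / 7) ^ 2) *
      (16807/16000 + 5563889567369/2050064640000 * w + 19767066974753/6833548800000 * w ^ 2
        + 825848096857/569462400000 * w ^ 3 + 5780936677999/20500646400000 * w ^ 4) =
      1 - w * (157236499/158184000 + 1499718451/3163680000 * (1 - w ^ 2)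
        + 928900250971/2277849600000 * (1 - w ^ 2) ^ 2
        + 579109672799/1138924800000 * (1 - w ^ 2) ^ 3
        + 5780936677999/20500646400000 * (1 - w ^ 2) ^ 4) := by ring
  rw [hI] at hQ
  set t := 1 - w ^ 2 with ht
  have ht1 : |t| ≤ 1 := abs_le.2 ⟨by linarith, by nlinarith⟩
  have ha2 : |t ^ 2| ≤ 1 := by rw [abs_pow]; exact pow_le_one₀ (abs_nonneg _) ht1
  have ha3 : |t ^ 3| ≤ 1 := by rw [abs_pow]; exact pow_le_one₀ (abs_nonneg _) ht1
  have ha4 : |t ^ 4| ≤ 1 := by rw [abs_pow]; exact pow_le_one₀ (abs_nonneg _) ht1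
  rw [abs_le] at ht1 ha2 ha3 ha4
  have hd : 0.9939 + 0.474 * t + 0.4078 * t ^ 2 + 0.5085 * t ^ 3 + 0.282 * t ^ 4 ≤
      157236499/158184000 + 1499718451/3163680000 * t + 928900250971/2277849600000 * t ^ 2
        + 579109672799/1138924800000 * t ^ 3 + 5780936677999/20500646400000 * t ^ 4 := by
    linarith [ht1.1, ht1.2, ha2.1, ha2.2, ha3.1, ha3.2, ha4.1, ha4.2]
  have := mul_le_mul_of_nonneg_left hd h0
  linarith

/-- With `S = |x|² + |y|²` and `t = 2 x·y / S`, the kernel `√S p(t)` for the polynomial `p` of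
`minorant_le`. -/
noncomputable def minorantKernel (x y : E3) : ℝ :=
  0.9939 * √(‖x‖ ^ 2 + ‖y‖ ^ 2) +
    0.474 * 2 * (dot x y * powKernel 1 (‖x‖ ^ 2 + ‖y‖ ^ 2)) +
    0.4078 * 4 * (dot x y ^ 2 * powKernel 2 (‖x‖ ^ 2 + ‖y‖ ^ 2)) +
    0.5085 * 8 * (dot x y ^ 3 * powKernel 3 (‖x‖ ^ 2 + ‖y‖ ^ 2)) +
    0.282 * 16 * (dot x y ^ 4 * powKernel 4 (‖x‖ ^ 2 + ‖y‖ ^ 2))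

lemma minorantKernel_le_pairTerm {x y : E3} (h : x ≠ y) : minorantKernel x y ≤ pairTerm x y := by
  have hd : 0 < ‖x - y‖ := norm_pos_iff.2 (sub_ne_zero.2 h)
  have hd2 := norm_sub_sq_eq_dot x y
  have hs2 : 0 ≤ ‖x‖ ^ 2 + ‖y‖ ^ 2 + 2 * dot x y := by
    simp only [norm_sq_eq_coord, dot]
    nlinarith [sq_nonneg (x 0 + y 0), sq_nonneg (x 1 + y 1), sq_nonneg (x 2 + y 2)]
  have hS : 0 < ‖x‖ ^ 2 + ‖y‖ ^ 2 := by nlinarith [pow_pos hd 2]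
  unfold minorantKernel pairTerm powKernel
  generalize ‖x‖ ^ 2 + ‖y‖ ^ 2 = S at *
  generalize dot x y = c at *
  generalize ‖x - y‖ = d at *
  have hq : 0 < √S := Real.sqrt_pos.2 hS
  have hqq : √S ^ 2 = S := Real.sq_sqrt hS.le
  have hw2 : (d / √S) ^ 2 = (S - 2 * c) / S := by rw [div_pow, hqq, hd2]
  have ht : 1 - (d / √S) ^ 2 = 2 * c / S := by rw [hw2]; field_simp; ring
  have hm := minorant_le (w := d / √S) (by positivity) (by
    rw [hw2, div_le_iff₀ hS]; linarith)
  rw [ht] at hm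
  rw [le_div_iff₀ hd]
  calc _ = S * (d / √S * (0.9939 + 0.474 * (2 * c / S) + 0.4078 * (2 * c / S) ^ 2
        + 0.5085 * (2 * c / S) ^ 3 + 0.282 * (2 * c / S) ^ 4)) := by
        rw [show S * (d / √S * (0.9939 + 0.474 * (2 * c / S) + 0.4078 * (2 * c / S) ^ 2
          + 0.5085 * (2 * c / S) ^ 3 + 0.282 * (2 * c / S) ^ 4)) = √S ^ 2 * d / √S *
          (0.9939 + 0.474 * (2 * c / S) + 0.4078 * (2 * c / S) ^ 2
          + 0.5085 * (2 * c / S) ^ 3 + 0.282 * (2 * c / S) ^ 4) by rw [hqq]; ring]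
        rw [show √S ^ 2 * d / √S = √S * d by field_simp]
        ring
    _ ≤ S * 1 := by gcongr
    _ = S := mul_one _

lemma minorantKernel_self_le (x : E3) : minorantKernel x x ≤ 4 * ‖x‖ := by
  rcases eq_or_ne x 0 with rfl | hx
  · simp [minorantKernel, dot]
  have hr : 0 < ‖x‖ := norm_pos_iff.2 hx
  have hc : dot x x = ‖x‖ ^ 2 := by rw [norm_sq_eq_coord, dot]; ring
  unfold minorantKernel powKernel
  rw [hc]
  generalize ‖x‖ = r at *
  have hs : √(r ^ 2 + r ^ 2) = √2 * r := by
    rw [show r ^ 2 + r ^ 2 = 2 * r ^ 2 by ring, Real.sqrt_mul zero_le_two, Real.sqrt_sq hr.le]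
  rw [hs]
  have h2 : √2 ≤ 1.42 := by rw [Real.sqrt_le_left (by norm_num)]; norm_num
  calc _ = (0.9939 + 0.474 + 0.4078 + 0.5085 + 0.282) * (√2 * r) := by
        field_simp; ring
    _ ≤ (0.9939 + 0.474 + 0.4078 + 0.5085 + 0.282) * (1.42 * r) := by gcongr
    _ ≤ 4 * r := by nlinarith

section sums

variable {N : ℕ} (x : Fin N → E3)

lemma sum_feature_nonneg {n : ℕ} (hn : 1 ≤ n) (φ : E3 → ℝ) (h0 : φ 0 = 0) :
    0 ≤ ∑ i, ∑ j, φ (x i) * φ (x j) * powKernel n (‖x i‖ ^ 2 + ‖x j‖ ^ 2) :=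
  powKernel_posDef Finset.univ hn (fun i => φ (x i)) (fun i => ‖x i‖ ^ 2)
    (fun i => sq_nonneg _) (fun i hi => by
      have : x i = 0 := by simpa using hi
      simp [this, h0])

lemma sum_features_nonneg {κ : Type*} (s : Finset κ) {n : ℕ} (hn : 1 ≤ n) (c : κ → ℝ)
    (hc : ∀ k, 0 ≤ c k) (φ : κ → E3 → ℝ) (h0 : ∀ k, φ k 0 = 0) :
    0 ≤ ∑ i, ∑ j, (∑ k ∈ s, c k * (φ k (x i) * φ k (x j))) *
      powKernel n (‖x i‖ ^ 2 + ‖x j‖ ^ 2) := by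
  have h : ∑ i, ∑ j, (∑ k ∈ s, c k * (φ k (x i) * φ k (x j))) *
      powKernel n (‖x i‖ ^ 2 + ‖x j‖ ^ 2) =
      ∑ k ∈ s, c k * ∑ i, ∑ j, φ k (x i) * φ k (x j) *
        powKernel n (‖x i‖ ^ 2 + ‖x j‖ ^ 2) := by
    simp_rw [Finset.sum_mul]
    rw [Finset.sum_congr rfl fun i _ => Finset.sum_comm, Finset.sum_comm]
    refine Finset.sum_congr rfl fun k _ => ?_
    rw [Finset.mul_sum]
    refine Finset.sum_congr rfl fun i _ => ?_
    rw [Finset.mul_sum]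
    exact Finset.sum_congr rfl fun j _ => by ring
  rw [h]
  exact Finset.sum_nonneg fun k _ => mul_nonneg (hc k) (sum_feature_nonneg x hn _ (h0 k))

lemma sum_dot_nonneg : 0 ≤ ∑ i, ∑ j, dot (x i) (x j) *
    powKernel 1 (‖x i‖ ^ 2 + ‖x j‖ ^ 2) := by
  refine le_of_le_of_eq (sum_features_nonneg x (Finset.univ : Finset (Fin 3)) le_rfl
    (fun _ => 1) (fun _ => zero_le_one) (fun k y => y k) (fun k => rfl)) ?_
  refine Finset.sum_congr rfl fun i _ => Finset.sum_congr rfl fun j _ => ?_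
  rw [Fin.sum_univ_three, dot]; ring

lemma sum_dot_sq_ge : 0 ≤ ∑ i, ∑ j, (dot (x i) (x j) ^ 2 - ‖x i‖ ^ 2 * ‖x j‖ ^ 2 / 3) *
    powKernel 2 (‖x i‖ ^ 2 + ‖x j‖ ^ 2) := by
  refine le_of_le_of_eq (sum_features_nonneg x (Finset.univ : Finset (Fin 3 × Fin 3))
    one_le_two (fun _ => 1) (fun _ => zero_le_one)
    (fun k y => y k.1 * y k.2 - if k.1 = k.2 then ‖y‖ ^ 2 / 3 else 0) (fun k => by simp)) ?_
  refine Finset.sum_congr rfl fun i _ => Finset.sum_congr rfl fun j _ => ?_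
  congr 1
  simp only [Fintype.sum_prod_type, Fin.sum_univ_three, norm_sq_eq_coord, dot]
  simp
  ring

lemma sum_dot_cube_nonneg : 0 ≤ ∑ i, ∑ j, dot (x i) (x j) ^ 3 *
    powKernel 3 (‖x i‖ ^ 2 + ‖x j‖ ^ 2) := by
  refine le_of_le_of_eq (sum_features_nonneg x
    (Finset.univ : Finset (Fin 3 × Fin 3 × Fin 3)) (n := 3) (by norm_num)
    (fun _ => 1) (fun _ => zero_le_one)
    (fun k y => y k.1 * y k.2.1 * y k.2.2) (fun k => by simp)) ?_
  refine Finset.sum_congr rfl fun i _ => Finset.sum_congr rfl fun j _ => ?_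
  congr 1
  simp only [Fintype.sum_prod_type, Fin.sum_univ_three, dot]
  ring

/-- The features are the quartic monomials minus their spherical averages. -/
lemma sum_dot_pow_four_ge : 0 ≤ ∑ i, ∑ j, (dot (x i) (x j) ^ 4 -
    ‖x i‖ ^ 4 * ‖x j‖ ^ 4 / 5) * powKernel 4 (‖x i‖ ^ 2 + ‖x j‖ ^ 2) := by
  refine le_of_le_of_eq (sum_features_nonneg x (Finset.univ : Finset (Fin 15)) (n := 4)
    (by norm_num)
    ![1, 1, 1, 6, 6, 6, 4, 4, 4, 4, 4, 4, 12, 12, 12]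
    (fun k => by fin_cases k <;> norm_num)
    (fun k y => (![y 0 ^ 4 - (‖y‖ ^ 2) ^ 2 / 5, y 1 ^ 4 - (‖y‖ ^ 2) ^ 2 / 5,
      y 2 ^ 4 - (‖y‖ ^ 2) ^ 2 / 5, y 0 ^ 2 * y 1 ^ 2 - (‖y‖ ^ 2) ^ 2 / 15,
      y 1 ^ 2 * y 2 ^ 2 - (‖y‖ ^ 2) ^ 2 / 15, y 2 ^ 2 * y 0 ^ 2 - (‖y‖ ^ 2) ^ 2 / 15,
      y 0 ^ 3 * y 1, y 0 ^ 3 * y 2, y 1 ^ 3 * y 0, y 1 ^ 3 * y 2, y 2 ^ 3 * y 0, y 2 ^ 3 * y 1,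
      y 0 ^ 2 * y 1 * y 2, y 1 ^ 2 * y 2 * y 0, y 2 ^ 2 * y 0 * y 1] : Fin 15 → ℝ) k)
    (fun k => by fin_cases k <;> simp)) ?_
  refine Finset.sum_congr rfl fun i _ => Finset.sum_congr rfl fun j _ => ?_
  congr 1
  have e : ∀ y : E3, ‖y‖ ^ 4 = (y 0 ^ 2 + y 1 ^ 2 + y 2 ^ 2) ^ 2 := fun y => by
    rw [← norm_sq_eq_coord]; ring
  simp only [Fin.sum_univ_succ, Fin.sum_univ_zero, Matrix.cons_val_zero, Matrix.cons_val_succ,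
    e, norm_sq_eq_coord, dot]
  ring

end sums

/-- The part of `minorantKernel` that is left after removing positive definite kernels. -/
lemma radial_part_ge {r s : ℝ} (hr : 0 ≤ r) (hs : 0 ≤ s) :
    0.8218 * (r + s) ≤ 0.9939 * √(r ^ 2 + s ^ 2) +
      0.4078 * 4 * (r ^ 2 * s ^ 2 / 3 * powKernel 2 (r ^ 2 + s ^ 2)) +
      0.282 * 16 * (r ^ 4 * s ^ 4 / 5 * powKernel 4 (r ^ 2 + s ^ 2)) := by
  rcases eq_or_lt_of_le (add_nonneg (sq_nonneg r) (sq_nonneg s)) with h | h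
  · have hr0 : r = 0 := by nlinarith
    have hs0 : s = 0 := by nlinarith
    simp [hr0, hs0]
  unfold powKernel
  have hq : 0 < √(r ^ 2 + s ^ 2) := Real.sqrt_pos.2 h
  have hqq : √(r ^ 2 + s ^ 2) ^ 2 = r ^ 2 + s ^ 2 := Real.sq_sqrt h.le
  set q := √(r ^ 2 + s ^ 2) with hqdef
  rw [← hqq]
  set T := 2 * (r * s) / q ^ 2 with hT
  -- `(r + s)² = q² (1 + T)`; the linear bound is the tangent of `√(1 + T)` near the minimum
  have h1 : (r + s) / q ≤ (2.7689 + T) / 2.66 := by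
    have h2 : ((r + s) / q) ^ 2 = 1 + T := by
      rw [hT, div_pow]; field_simp; rw [hqq]; ring
    rw [le_div_iff₀ (by norm_num)]
    nlinarith [sq_nonneg ((r + s) / q - 1.33)]
  have h3 : 0.8218 * ((2.7689 + T) / 2.66) ≤ 0.9939 + 0.4078 * T ^ 2 / 3 + 0.282 * T ^ 4 / 5 := by
    -- the difference is least near `T = 0.766`
    have h4 : 0 ≤ (T ^ 2 - 0.585) ^ 2 := sq_nonneg _
    have h5 : 0 ≤ (T - 0.766) ^ 2 := sq_nonneg _
    have h6 : 0 ≤ T := by positivity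
    ring_nf at h4 h5 ⊢
    linarith
  calc 0.8218 * (r + s) = q * (0.8218 * ((r + s) / q)) := by field_simp
    _ ≤ q * (0.9939 + 0.4078 * T ^ 2 / 3 + 0.282 * T ^ 4 / 5) :=
      mul_le_mul_of_nonneg_left (by linarith) hq.le
    _ = _ := by rw [hT]; field_simp; ring

lemma le_pairSum {N : ℕ} {x : Fin N → E3} (hx : Function.Injective x) :
    2 * ((0.8218 * N - 2) * ∑ i, ‖x i‖) ≤ pairSum x := by
  have h1 : ∑ i, ∑ j, minorantKernel (x i) (x j) ≤ pairSum x + ∑ i, 4 * ‖x i‖ := by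
    rw [pairSum, ← Finset.sum_add_distrib]
    refine Finset.sum_le_sum fun i _ => ?_
    rw [← Finset.add_sum_erase _ _ (Finset.mem_univ i),
      ← Finset.add_sum_erase _ (fun j => pairTerm (x i) (x j)) (Finset.mem_univ i),
      pairTerm_self, zero_add, add_comm]
    exact add_le_add (Finset.sum_le_sum fun j hj => minorantKernel_le_pairTerm
      (hx.ne (Finset.ne_of_mem_erase hj).symm)) (minorantKernel_self_le _)
  have h2 : ∑ i, ∑ j, (0.8218 * (‖x i‖ + ‖x j‖)) ≤ ∑ i, ∑ j, minorantKernel (x i) (x j) := by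
    have h : ∀ i j, 0.8218 * (‖x i‖ + ‖x j‖) + (0.474 * 2 * (dot (x i) (x j) *
        powKernel 1 (‖x i‖ ^ 2 + ‖x j‖ ^ 2)) + 0.4078 * 4 * ((dot (x i) (x j) ^ 2 -
        ‖x i‖ ^ 2 * ‖x j‖ ^ 2 / 3) * powKernel 2 (‖x i‖ ^ 2 + ‖x j‖ ^ 2)) +
        0.5085 * 8 * (dot (x i) (x j) ^ 3 * powKernel 3 (‖x i‖ ^ 2 + ‖x j‖ ^ 2)) +
        0.282 * 16 * ((dot (x i) (x j) ^ 4 - ‖x i‖ ^ 4 * ‖x j‖ ^ 4 / 5) *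
        powKernel 4 (‖x i‖ ^ 2 + ‖x j‖ ^ 2))) ≤ minorantKernel (x i) (x j) := by
      intro i j
      have := radial_part_ge (norm_nonneg (x i)) (norm_nonneg (x j))
      unfold minorantKernel
      linarith
    refine le_trans ?_ (Finset.sum_le_sum fun i _ => Finset.sum_le_sum fun j _ => h i j)
    simp only [Finset.sum_add_distrib, ← Finset.mul_sum]
    have h1 := sum_dot_nonneg x
    have h2 := sum_dot_sq_ge x
    have h3 := sum_dot_cube_nonneg x
    have h4 := sum_dot_pow_four_ge x
    linarith
  have h3 : ∑ i, ∑ j, (0.8218 * (‖x i‖ + ‖x j‖)) = 2 * (0.8218 * N * ∑ i, ‖x i‖) := by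
    simp only [← Finset.mul_sum, Finset.sum_add_distrib, Finset.sum_const, Finset.card_univ,
      Fintype.card_fin, nsmul_eq_mul]
    ring
  rw [← Finset.mul_sum] at h1
  linarith

theorem le_beta (hβ : betaENN ≠ ∞) : 0.8218 ≤ beta := by
  have h : ∀ᶠ N : ℕ in atTop, 0.8218 - 2 / (N : ℝ) ≤ beta * (1 - 1 / (N : ℝ)) := by
    filter_upwards [eventually_ge_atTop 2] with N hN
    have hN2 : (2 : ℝ) ≤ N := by exact_mod_cast hN
    have hN1 : (0 : ℝ) < (N : ℝ) - 1 := by linarith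
    have h1 : (0.8218 * N - 2) / ((N : ℝ) - 1) ≤ alpha N := by
      refine le_alpha hN fun x hx => ?_
      refine le_of_eq_of_le ?_ (le_pairSum hx)
      field_simp
    have h2 := h1.trans (alpha_le_beta hN hβ)
    rw [div_le_iff₀ hN1] at h2
    have hN0 : (0 : ℝ) < N := by linarith
    rw [← mul_le_mul_iff_of_pos_right hN0]
    calc _ = 0.8218 * (N : ℝ) - 2 := by field_simp
      _ ≤ _ := h2
      _ = _ := by field_simp
  have hinv : Tendsto (fun N : ℕ => 1 / (N : ℝ)) atTop (𝓝 0) := tendsto_one_div_atTop_nhds_zero_nat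
  have hL : Tendsto (fun N : ℕ => 0.8218 - 2 / (N : ℝ)) atTop (𝓝 (0.8218 - 2 * 0)) := by
    refine (tendsto_const_nhds.sub (hinv.const_mul 2)).congr fun N => ?_
    ring
  have hR : Tendsto (fun N : ℕ => beta * (1 - 1 / (N : ℝ))) atTop (𝓝 (beta * (1 - 0))) :=
    (tendsto_const_nhds.sub hinv).const_mul _
  have := le_of_tendsto_of_tendsto hL hR h
  linarith

/-! ### Gaussian smearing -/

/-- The density of the centred Gaussian with covariance `θ I` on `ℝ³`. -/
noncomputable def heat (θ : ℝ) (u : E3) : ℝ :=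
  (√(2 * Real.pi * θ) ^ 3)⁻¹ * Real.exp (-‖u‖ ^ 2 / (2 * θ))

lemma heat_nonneg (θ : ℝ) (u : E3) : 0 ≤ heat θ u := by unfold heat; positivity

lemma heat_neg (θ : ℝ) (u : E3) : heat θ (-u) = heat θ u := by simp [heat]

lemma heat_sub_comm (θ : ℝ) (u v : E3) : heat θ (u - v) = heat θ (v - u) := by
  rw [← heat_neg, neg_sub]

@[fun_prop]
lemma measurable_heat : Measurable fun p : ℝ × E3 => heat p.1 p.2 := by
  unfold heat; fun_prop

lemma integral_exp_neg_mul_norm_sq {b : ℝ} (hb : 0 < b) :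
    ∫ x : E3, Real.exp (-b * ‖x‖ ^ 2) = √(Real.pi / b) ^ 3 := by
  rw [GaussianFourier.integral_rexp_neg_mul_sq_norm hb, Real.sqrt_eq_rpow, ← Real.rpow_natCast,
    ← Real.rpow_mul (by have := Real.pi_pos; positivity)]
  simp
  norm_num

lemma integral_norm_sq_mul_exp {b : ℝ} (hb : 0 < b) :
    ∫ x : E3, ‖x‖ ^ 2 * Real.exp (-b * ‖x‖ ^ 2) =
      3 / (2 * b) * ∫ x : E3, Real.exp (-b * ‖x‖ ^ 2) := by
  have h1 := integral_fun_norm_addHaar (volume : Measure E3)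
    (fun r => r ^ 2 * Real.exp (-b * r ^ 2))
  have h0 := integral_fun_norm_addHaar (volume : Measure E3) (fun r => Real.exp (-b * r ^ 2))
  have e1 : ∫ y in Set.Ioi (0 : ℝ), y ^ 2 * (y ^ 2 * Real.exp (-b * y ^ 2)) =
      b ^ (-(5 : ℝ) / 2) * (1 / 2) * Real.Gamma (5 / 2) := by
    have := integral_rpow_mul_exp_neg_mul_rpow (p := 2) (q := 4) (b := b) (by norm_num)
      (by norm_num) hb
    norm_num at this ⊢
    rw [← this]
    refine setIntegral_congr_fun measurableSet_Ioi fun y _ => ?_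
    ring
  have e0 : ∫ y in Set.Ioi (0 : ℝ), y ^ 2 * Real.exp (-b * y ^ 2) =
      b ^ (-(3 : ℝ) / 2) * (1 / 2) * Real.Gamma (3 / 2) := by
    have := integral_rpow_mul_exp_neg_mul_rpow (p := 2) (q := 2) (b := b) (by norm_num)
      (by norm_num) hb
    norm_num at this ⊢
    exact this
  have hG : Real.Gamma (5 / 2) = 3 / 2 * Real.Gamma (3 / 2) := by
    rw [← Real.Gamma_add_one (by norm_num)]; norm_num
  have hp : b ^ (-(5 : ℝ) / 2) = b⁻¹ * b ^ (-(3 : ℝ) / 2) := by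
    rw [← Real.rpow_neg_one, ← Real.rpow_add hb]; norm_num
  simp only [finrank_euclideanSpace, Fintype.card_fin, smul_eq_mul, nsmul_eq_mul] at h0 h1
  norm_num at h0 h1 e0 e1 hp ⊢
  rw [h1, h0, e1, e0, hG, hp]
  field_simp

lemma heat_eq_exp (θ : ℝ) (x : E3) :
    heat θ x = (√(2 * Real.pi * θ) ^ 3)⁻¹ * Real.exp (-(1 / (2 * θ)) * ‖x‖ ^ 2) := by
  unfold heat; congr 2; ring

lemma integral_heat {θ : ℝ} (hθ : 0 < θ) : ∫ x : E3, heat θ x = 1 := by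
  simp_rw [heat_eq_exp]
  rw [integral_const_mul, integral_exp_neg_mul_norm_sq (by positivity)]
  have : Real.pi / (1 / (2 * θ)) = 2 * Real.pi * θ := by field_simp
  rw [this]
  have hp := Real.pi_pos
  have : 0 < √(2 * Real.pi * θ) := by positivity
  field_simp

lemma integral_norm_sq_mul_heat {θ : ℝ} (hθ : 0 < θ) : ∫ x : E3, ‖x‖ ^ 2 * heat θ x = 3 * θ := by
  have h := integral_heat hθ
  simp_rw [heat_eq_exp, mul_left_comm] at h ⊢
  rw [integral_const_mul] at h ⊢
  rw [integral_norm_sq_mul_exp (by positivity), mul_left_comm, h]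
  field_simp

/-- The integral would be zero if the function were not integrable. -/
lemma integrable_heat {θ : ℝ} (hθ : 0 < θ) : Integrable fun x : E3 => heat θ x := by
  by_contra h
  have := integral_heat hθ
  rw [integral_undef h] at this
  exact zero_ne_one this

lemma integrable_norm_sq_mul_heat {θ : ℝ} (hθ : 0 < θ) :
    Integrable fun x : E3 => ‖x‖ ^ 2 * heat θ x := by
  by_contra h
  have := integral_norm_sq_mul_heat hθ
  rw [integral_undef h] at this
  linarith

/-- The Gaussian measure on `ℝ³` with mean `a` and covariance `θ I`. -/
noncomputable def gauss (a : E3) (θ : ℝ) : Measure E3 :=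
  volume.withDensity fun x => ENNReal.ofReal (heat θ (x - a))

lemma lintegral_gauss (a : E3) (θ : ℝ) {f : E3 → ℝ≥0∞} (hf : Measurable f) :
    ∫⁻ x, f x ∂gauss a θ = ∫⁻ x, ENNReal.ofReal (heat θ (x - a)) * f x := by
  rw [gauss, lintegral_withDensity_eq_lintegral_mul _ (by fun_prop) hf]
  rfl

lemma lintegral_gauss_shift (a : E3) (θ : ℝ) {f : E3 → ℝ≥0∞} (hf : Measurable f) :
    ∫⁻ x, f x ∂gauss a θ = ∫⁻ v, ENNReal.ofReal (heat θ v) * f (v + a) := by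
  rw [lintegral_gauss a θ hf,
    ← lintegral_sub_right_eq_self (fun v => ENNReal.ofReal (heat θ v) * f (v + a)) a]
  simp

lemma lintegral_heat {θ : ℝ} (hθ : 0 < θ) : ∫⁻ x : E3, ENNReal.ofReal (heat θ x) = 1 := by
  rw [← ofReal_integral_eq_lintegral_ofReal (integrable_heat hθ)
    (ae_of_all _ fun x => heat_nonneg θ x), integral_heat hθ, ENNReal.ofReal_one]

lemma isProbabilityMeasure_gauss (a : E3) {θ : ℝ} (hθ : 0 < θ) :
    IsProbabilityMeasure (gauss a θ) := ⟨by
  rw [← lintegral_one, lintegral_gauss_shift a θ measurable_const]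
  simpa using lintegral_heat hθ⟩

lemma lintegral_norm_sq_gauss (a : E3) {θ : ℝ} (hθ : 0 < θ) :
    ∫⁻ x, ‖x‖ₑ ^ 2 ∂gauss a θ = ENNReal.ofReal (‖a‖ ^ 2 + 3 * θ) := by
  rw [lintegral_gauss_shift a θ (by fun_prop)]
  have hi1 := integrable_norm_sq_mul_heat hθ
  have hi0 := (integrable_heat hθ).const_mul (‖a‖ ^ 2)
  have hic : Integrable fun v : E3 => 2 * inner ℝ v a * heat θ v := by
    refine (hi1.add hi0).mono' (by unfold heat; fun_prop) (ae_of_all _ fun v => ?_)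
    rw [Real.norm_eq_abs, abs_mul, abs_of_nonneg (heat_nonneg θ v), Pi.add_apply, ← add_mul]
    refine mul_le_mul_of_nonneg_right ?_ (heat_nonneg θ v)
    have h1 := abs_real_inner_le_norm v a
    rw [abs_mul, abs_of_pos (zero_lt_two (α := ℝ))]
    nlinarith [sq_nonneg (‖v‖ - ‖a‖)]
  have hodd : ∫ v : E3, 2 * inner ℝ v a * heat θ v = 0 := by
    have h := integral_neg_eq_self (fun v : E3 => 2 * inner ℝ v a * heat θ v) volume
    simp only [heat_neg, inner_neg_left, mul_neg, neg_mul, integral_neg] at h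
    linarith
  have he : ∀ v : E3, ENNReal.ofReal (heat θ v) * ‖v + a‖ₑ ^ 2 =
      ENNReal.ofReal (‖v‖ ^ 2 * heat θ v + 2 * inner ℝ v a * heat θ v + ‖a‖ ^ 2 * heat θ v) := by
    intro v
    rw [← ofReal_norm, ← ENNReal.ofReal_pow (norm_nonneg _),
      ← ENNReal.ofReal_mul (heat_nonneg θ v), norm_add_sq_real]
    congr 1; ring
  simp_rw [he]
  have hi2 : Integrable fun v : E3 => ‖v‖ ^ 2 * heat θ v + 2 * inner ℝ v a * heat θ v :=
    hi1.add hic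
  have hi3 : Integrable fun v : E3 =>
    ‖v‖ ^ 2 * heat θ v + 2 * inner ℝ v a * heat θ v + ‖a‖ ^ 2 * heat θ v := hi2.add hi0
  rw [← ofReal_integral_eq_lintegral_ofReal hi3]
  · rw [integral_add hi2 hi0, integral_add hi1 hic, hodd, integral_const_mul,
      integral_heat hθ, integral_norm_sq_mul_heat hθ]
    congr 1; ring
  · refine ae_of_all _ fun v => ?_
    have : ‖v‖ ^ 2 * heat θ v + 2 * inner ℝ v a * heat θ v + ‖a‖ ^ 2 * heat θ v =
        ‖v + a‖ ^ 2 * heat θ v := by rw [norm_add_sq_real]; ring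
    simp only [Pi.zero_apply]
    rw [this]
    exact mul_nonneg (sq_nonneg _) (heat_nonneg θ v)

/-- Smearing does not decrease the first moment, by convexity of the norm. -/
lemma enorm_le_lintegral_gauss (a : E3) {θ : ℝ} (hθ : 0 < θ) :
    ‖a‖ₑ ≤ ∫⁻ x, ‖x‖ₑ ∂gauss a θ := by
  rw [lintegral_gauss_shift a θ (by fun_prop)]
  have h1 : ∫⁻ v, ENNReal.ofReal (heat θ v) * ‖v + a‖ₑ =
      ∫⁻ v, ENNReal.ofReal (heat θ v) * ‖-v + a‖ₑ := by
    rw [← lintegral_neg_eq_self]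
    simp only [heat_neg]
  have h2 : ∫⁻ v, ENNReal.ofReal (heat θ v) * (‖a‖ₑ + ‖a‖ₑ) ≤
      ∫⁻ v, (ENNReal.ofReal (heat θ v) * ‖v + a‖ₑ + ENNReal.ofReal (heat θ v) * ‖-v + a‖ₑ) := by
    refine lintegral_mono fun v => ?_
    simp only
    rw [← mul_add]
    refine mul_le_mul' le_rfl ?_
    calc ‖a‖ₑ + ‖a‖ₑ = ‖(2 : ℝ) • a‖ₑ := by
          rw [enorm_smul, Real.enorm_of_nonneg zero_le_two]; simp [two_mul]
      _ = ‖(v + a) + (-v + a)‖ₑ := by congr 1; rw [two_smul]; abel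
      _ ≤ _ := enorm_add_le _ _
  rw [lintegral_add_left (by fun_prop), ← h1, lintegral_mul_const _ (by fun_prop),
    lintegral_heat hθ, one_mul, ← two_mul, ← two_mul] at h2
  exact (ENNReal.mul_le_mul_iff_right two_ne_zero ENNReal.ofNat_ne_top).1 h2

lemma lintegral_enorm_gauss_ne_top (a : E3) {θ : ℝ} (hθ : 0 < θ) :
    ∫⁻ x, ‖x‖ₑ ∂gauss a θ ≠ ∞ := by
  have := isProbabilityMeasure_gauss a hθ
  refine ne_top_of_le_ne_top (b := ∫⁻ x, (1 + ‖x‖ₑ ^ 2) ∂gauss a θ) ?_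
    (lintegral_mono fun x => ?_)
  · rw [lintegral_add_left measurable_const, lintegral_norm_sq_gauss a hθ]
    simp
  · simp only
    rcases le_total ‖x‖ₑ 1 with h | h
    · exact h.trans le_self_add
    · exact (le_self_pow₀ h two_ne_zero).trans le_add_self

/-- The product of two Gaussian densities is a multiple of a Gaussian density. -/
lemma heat_mul_heat {θ σ : ℝ} (hθ : 0 < θ) (hσ : 0 < σ) (x z a : E3) :
    heat θ (x - z) * heat σ (x - a) = heat (θ + σ) (a - z) *
      heat (θ * σ / (θ + σ)) (x - (a + (σ / (θ + σ)) • (z - a))) := by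
  have hp := Real.pi_pos
  unfold heat
  have h1 : √(2 * Real.pi * θ) * √(2 * Real.pi * σ) =
      √(2 * Real.pi * (θ + σ)) * √(2 * Real.pi * (θ * σ / (θ + σ))) := by
    rw [← Real.sqrt_mul (by positivity), ← Real.sqrt_mul (by positivity)]
    congr 1; field_simp
  have h2 : -‖x - z‖ ^ 2 / (2 * θ) + -‖x - a‖ ^ 2 / (2 * σ) = -‖a - z‖ ^ 2 / (2 * (θ + σ)) +
      -‖x - (a + (σ / (θ + σ)) • (z - a))‖ ^ 2 / (2 * (θ * σ / (θ + σ))) := by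
    simp only [norm_sq_eq_coord, PiLp.sub_apply, PiLp.add_apply, PiLp.smul_apply, smul_eq_mul]
    field_simp
    ring
  rw [mul_mul_mul_comm, ← Real.exp_add, ← mul_inv, ← mul_pow, h1, h2, mul_pow, mul_inv,
    Real.exp_add, mul_mul_mul_comm]

lemma lintegral_gauss_mul_heat {θ σ : ℝ} (hθ : 0 < θ) (hσ : 0 < σ) (z a : E3) {g : E3 → ℝ≥0∞}
    (hg : Measurable g) :
    ∫⁻ x, g x * ENNReal.ofReal (heat θ (x - z)) ∂gauss a σ =
      ENNReal.ofReal (heat (θ + σ) (a - z)) *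
        ∫⁻ x, g x ∂gauss (a + (σ / (θ + σ)) • (z - a)) (θ * σ / (θ + σ)) := by
  rw [lintegral_gauss _ _ (by fun_prop), lintegral_gauss _ _ hg, ← lintegral_const_mul _
    (by fun_prop)]
  refine lintegral_congr fun x => ?_
  have h := heat_mul_heat hθ hσ x z a
  have h' := congrArg ENNReal.ofReal h
  rw [ENNReal.ofReal_mul (heat_nonneg _ _), ENNReal.ofReal_mul (heat_nonneg _ _)] at h'
  rw [← mul_assoc (ENNReal.ofReal (heat (θ + σ) _)), ← h']
  ring

/-! ### The Newtonian potential of a Gaussian -/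

lemma heat_eq_rpow {θ : ℝ} (hθ : 0 < θ) (u : E3) :
    heat θ u = (√(2 * Real.pi) ^ 3)⁻¹ *
      (θ ^ (-(3 : ℝ) / 2) * Real.exp (-(‖u‖ ^ 2 / 2) * θ⁻¹)) := by
  have hp := Real.pi_pos
  unfold heat
  have h1 : √(2 * Real.pi * θ) ^ 3 = √(2 * Real.pi) ^ 3 * θ ^ ((3 : ℝ) / 2) := by
    rw [Real.sqrt_mul (by positivity), mul_pow, Real.sqrt_eq_rpow θ,
      ← Real.rpow_mul_natCast hθ.le]
    norm_num
  have h2 : -‖u‖ ^ 2 / (2 * θ) = -(‖u‖ ^ 2 / 2) * θ⁻¹ := by field_simp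
  rw [h1, h2, mul_inv, neg_div, Real.rpow_neg hθ.le]
  ring

/-- The Newtonian potential is the time integral of the heat kernel. -/
lemma integral_heat_time {u : E3} (hu : u ≠ 0) :
    ∫ θ in Set.Ioi (0 : ℝ), heat θ u = (2 * Real.pi * ‖u‖)⁻¹ := by
  have hn : 0 < ‖u‖ := norm_pos_iff.2 hu
  have hp := Real.pi_pos
  have h1 : ∫ θ in Set.Ioi (0 : ℝ), heat θ u = (√(2 * Real.pi) ^ 3)⁻¹ *
      ∫ θ in Set.Ioi (0 : ℝ), (|(-1 : ℝ)| * θ ^ ((-1 : ℝ) - 1)) •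
        ((θ ^ (-1 : ℝ)) ^ ((1 : ℝ) / 2 - 1) * Real.exp (-(‖u‖ ^ 2 / 2 * θ ^ (-1 : ℝ)))) := by
    rw [← integral_const_mul]
    refine setIntegral_congr_fun measurableSet_Ioi fun θ hθ => ?_
    rw [heat_eq_rpow hθ, abs_neg, abs_one, one_mul, smul_eq_mul, ← mul_assoc (θ ^ _),
      ← Real.rpow_mul (le_of_lt hθ), ← Real.rpow_add hθ, Real.rpow_neg_one, neg_mul]
    norm_num
  rw [h1, integral_comp_rpow_Ioi (fun y => y ^ ((1 : ℝ) / 2 - 1) *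
    Real.exp (-(‖u‖ ^ 2 / 2 * y))) (by norm_num),
    Real.integral_rpow_mul_exp_neg_mul_Ioi (by norm_num) (by positivity), Real.Gamma_one_half_eq,
    ← Real.sqrt_eq_rpow]
  have h2 : √(1 / (‖u‖ ^ 2 / 2)) = √2 / ‖u‖ := by
    rw [one_div_div, Real.sqrt_div zero_le_two, Real.sqrt_sq hn.le]
  have h3 : √(2 * Real.pi) = √2 * √Real.pi := Real.sqrt_mul zero_le_two _
  have h4 : √2 ^ 2 = 2 := Real.sq_sqrt zero_le_two
  have h5 : √Real.pi ^ 2 = Real.pi := Real.sq_sqrt hp.le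
  have h6 : 2 * Real.pi * ‖u‖ = √2 ^ 2 * √Real.pi ^ 2 * ‖u‖ := by rw [h4, h5]
  rw [h2, h3, h6]
  field_simp

lemma integrableOn_heat_time {u : E3} (hu : u ≠ 0) :
    IntegrableOn (fun θ => heat θ u) (Set.Ioi (0 : ℝ)) := by
  have hn : 0 < ‖u‖ := norm_pos_iff.2 hu
  have hp := Real.pi_pos
  by_contra h
  have h1 := integral_heat_time hu
  rw [integral_undef h] at h1
  have : 0 < (2 * Real.pi * ‖u‖)⁻¹ := by positivity
  linarith

lemma lintegral_heat_time {u : E3} (hu : u ≠ 0) :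
    ENNReal.ofReal (2 * Real.pi) * ∫⁻ θ in Set.Ioi (0 : ℝ), ENNReal.ofReal (heat θ u) =
      ‖u‖ₑ⁻¹ := by
  have hn : 0 < ‖u‖ := norm_pos_iff.2 hu
  have hp := Real.pi_pos
  rw [← ofReal_integral_eq_lintegral_ofReal (integrableOn_heat_time hu)
    (ae_of_all _ fun θ => heat_nonneg θ u), integral_heat_time hu,
    ← ENNReal.ofReal_mul (by positivity), ← ofReal_norm, ← ENNReal.ofReal_inv_of_pos hn]
  congr 1
  field_simp

lemma ae_gauss_ne (a z : E3) (θ : ℝ) : ∀ᵐ x ∂gauss a θ, x ≠ z := by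
  have h : ∀ᵐ x : E3, x ≠ z := by rw [ae_iff]; simp
  exact (withDensity_absolutelyContinuous _ _).ae_le h

lemma sFinite_gauss (a : E3) (θ : ℝ) : SFinite (gauss a θ) := by unfold gauss; infer_instance

lemma lintegral_Ioi_add (f : ℝ → ℝ≥0∞) (σ : ℝ) :
    ∫⁻ θ in Set.Ioi (0 : ℝ), f (θ + σ) = ∫⁻ θ in Set.Ioi σ, f θ := by
  have := (measurePreserving_add_right volume σ).setLIntegral_comp_preimage_emb
    (measurableEmbedding_addRight σ) f (Set.Ioi σ)
  simpa using this

/-- Integrating against a Gaussian and the Newtonian potential of a point `z`: the tilted measure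
at time `θ` is again Gaussian, with mean and variance as displayed. -/
lemma lintegral_gauss_mul_inv {σ : ℝ} (hσ : 0 < σ) (z a : E3) {g : E3 → ℝ≥0∞}
    (hg : Measurable g) :
    ∫⁻ x, g x * ‖x - z‖ₑ⁻¹ ∂gauss a σ = ENNReal.ofReal (2 * Real.pi) *
      ∫⁻ θ in Set.Ioi (0 : ℝ), ENNReal.ofReal (heat (θ + σ) (a - z)) *
        ∫⁻ x, g x ∂gauss (a + (σ / (θ + σ)) • (z - a)) (θ * σ / (θ + σ)) := by
  have := sFinite_gauss a σ
  have h1 : ∫⁻ x, g x * ‖x - z‖ₑ⁻¹ ∂gauss a σ = ∫⁻ x, (ENNReal.ofReal (2 * Real.pi) *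
      ∫⁻ θ in Set.Ioi (0 : ℝ), g x * ENNReal.ofReal (heat θ (x - z))) ∂gauss a σ := by
    refine lintegral_congr_ae ?_
    filter_upwards [ae_gauss_ne a z σ] with x hx
    rw [lintegral_const_mul _ (by unfold heat; fun_prop), mul_left_comm,
      lintegral_heat_time (sub_ne_zero.2 hx)]
  have hm : Measurable fun p : E3 × ℝ => g p.1 * ENNReal.ofReal (heat p.2 (p.1 - z)) := by
    unfold heat; fun_prop
  rw [h1, lintegral_const_mul _ hm.lintegral_prod_right', lintegral_lintegral_swap hm.aemeasurable]
  congr 1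
  refine setLIntegral_congr_fun measurableSet_Ioi fun θ hθ => ?_
  exact lintegral_gauss_mul_heat hθ hσ z a hg

lemma lintegral_gauss_inv {σ : ℝ} (hσ : 0 < σ) (z a : E3) :
    ∫⁻ x, ‖x - z‖ₑ⁻¹ ∂gauss a σ = ENNReal.ofReal (2 * Real.pi) *
      ∫⁻ θ in Set.Ioi σ, ENNReal.ofReal (heat θ (a - z)) := by
  have h := lintegral_gauss_mul_inv hσ z a (g := fun _ => 1) measurable_const
  simp only [one_mul] at h
  rw [h]
  congr 1
  refine Eq.trans ?_ (lintegral_Ioi_add _ σ)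
  refine setLIntegral_congr_fun measurableSet_Ioi fun θ hθ => ?_
  have hθ' : 0 < θ := hθ
  have := isProbabilityMeasure_gauss (a + (σ / (θ + σ)) • (z - a))
    (show 0 < θ * σ / (θ + σ) by positivity)
  simp

/-- Smearing lowers the Newtonian potential. -/
lemma lintegral_gauss_inv_le {σ : ℝ} (hσ : 0 < σ) (z a : E3) :
    ∫⁻ x, ‖x - z‖ₑ⁻¹ ∂gauss a σ ≤ ‖a - z‖ₑ⁻¹ := by
  rcases eq_or_ne a z with rfl | h
  · simp
  rw [lintegral_gauss_inv hσ, ← lintegral_heat_time (sub_ne_zero.2 h)]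
  exact mul_le_mul' le_rfl (lintegral_mono_set (Set.Ioi_subset_Ioi hσ.le))

lemma lintegral_gauss_norm_sq_mul_inv {σ : ℝ} (hσ : 0 < σ) (z a : E3) :
    ∫⁻ x, ‖x‖ₑ ^ 2 * ‖x - z‖ₑ⁻¹ ∂gauss a σ = ENNReal.ofReal (2 * Real.pi) *
      ∫⁻ θ in Set.Ioi σ, ENNReal.ofReal (heat θ (a - z) *
        (‖a + (σ / θ) • (z - a)‖ ^ 2 + 3 * σ * (1 - σ / θ))) := by
  rw [lintegral_gauss_mul_inv hσ z a (g := fun x => ‖x‖ₑ ^ 2) (by fun_prop)]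
  congr 1
  refine Eq.trans ?_ (lintegral_Ioi_add _ σ)
  refine setLIntegral_congr_fun measurableSet_Ioi fun θ hθ => ?_
  have hθ' : 0 < θ := hθ
  have e : 3 * (θ * σ / (θ + σ)) = 3 * σ * (1 - σ / (θ + σ)) := by field_simp; ring
  rw [lintegral_norm_sq_gauss _ (show 0 < θ * σ / (θ + σ) by positivity),
    ← ENNReal.ofReal_mul (heat_nonneg _ _), e]

lemma hasDerivAt_heat {θ : ℝ} (hθ : 0 < θ) (u : E3) :
    HasDerivAt (fun θ => heat θ u)
      (heat θ u * (-(3 / 2) / θ + ‖u‖ ^ 2 / 2 / θ ^ 2)) θ := by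
  have h1 : HasDerivAt (fun θ : ℝ => (√(2 * Real.pi) ^ 3)⁻¹ *
      (θ ^ (-(3 : ℝ) / 2) * Real.exp (-(‖u‖ ^ 2 / 2) * θ⁻¹)))
      ((√(2 * Real.pi) ^ 3)⁻¹ * ((-(3 : ℝ) / 2) * θ ^ (-(3 : ℝ) / 2 - 1) *
        Real.exp (-(‖u‖ ^ 2 / 2) * θ⁻¹) + θ ^ (-(3 : ℝ) / 2) *
        (Real.exp (-(‖u‖ ^ 2 / 2) * θ⁻¹) * (-(‖u‖ ^ 2 / 2) * -(θ ^ 2)⁻¹)))) θ :=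
    ((Real.hasDerivAt_rpow_const (Or.inl hθ.ne')).mul
      (((hasDerivAt_inv hθ.ne').const_mul _).exp)).const_mul _
  have h2 := h1.congr_of_eventuallyEq (f₁ := fun θ => heat θ u) (by
    filter_upwards [lt_mem_nhds hθ] with s hs using heat_eq_rpow hs u)
  refine h2.congr_deriv ?_
  rw [heat_eq_rpow hθ, Real.rpow_sub_one hθ.ne']
  field_simp

lemma tendsto_mul_heat (σ : ℝ) (u : E3) :
    Tendsto (fun θ => 2 * σ * (θ - σ) * heat θ u) atTop (𝓝 0) := by
  have h0 : ∀ p : ℝ, 0 < p → Tendsto (fun θ : ℝ => θ ^ (-p)) atTop (𝓝 0) :=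
    fun p hp => tendsto_rpow_neg_atTop hp
  have hA : Tendsto (fun θ : ℝ => θ ^ (-(1 / 2 : ℝ)) - σ * θ ^ (-(3 / 2 : ℝ))) atTop (𝓝 0) := by
    simpa using (h0 (1 / 2) (by norm_num)).sub ((h0 (3 / 2) (by norm_num)).const_mul σ)
  have hE : Tendsto (fun θ : ℝ => Real.exp (-(‖u‖ ^ 2 / 2) * θ⁻¹)) atTop (𝓝 1) := by
    have := (tendsto_inv_atTop_zero (𝕜 := ℝ)).const_mul (-(‖u‖ ^ 2 / 2))
    rw [mul_zero] at this
    simpa [Function.comp_def] using (Real.continuous_exp.tendsto 0).comp this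
  have h := ((hA.mul hE).const_mul (2 * σ * (√(2 * Real.pi) ^ 3)⁻¹))
  rw [zero_mul, mul_zero] at h
  refine h.congr' ?_
  filter_upwards [eventually_gt_atTop 0] with θ hθ
  rw [heat_eq_rpow hθ, show -(1 / 2 : ℝ) = -(3 : ℝ) / 2 + 1 by norm_num, Real.rpow_add_one hθ.ne',
    show -(3 / 2 : ℝ) = -(3 : ℝ) / 2 by norm_num]
  ring

/-- The identity `∫_σ^∞ d/dθ (2 σ (θ - σ) heat θ u) dθ = 0`, in which the derivative is written
out. -/
lemma integral_heat_deriv {σ : ℝ} (hσ : 0 < σ) {u : E3} (hu : u ≠ 0) :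
    IntegrableOn (fun θ => heat θ u * (-σ + 3 * σ * (σ / θ) + σ / θ * (1 - σ / θ) * ‖u‖ ^ 2))
      (Set.Ioi σ) ∧
    ∫ θ in Set.Ioi σ, heat θ u * (-σ + 3 * σ * (σ / θ) + σ / θ * (1 - σ / θ) * ‖u‖ ^ 2) = 0 := by
  have hd : ∀ θ : ℝ, 0 < θ → HasDerivAt (fun θ => 2 * σ * (θ - σ) * heat θ u)
      (heat θ u * (-σ + 3 * σ * (σ / θ) + σ / θ * (1 - σ / θ) * ‖u‖ ^ 2)) θ := by
    intro θ hθ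
    have h1 := (((hasDerivAt_id θ).sub_const σ).const_mul (2 * σ)).mul (hasDerivAt_heat hθ u)
    refine h1.congr_deriv ?_
    simp only [id]
    field_simp
    ring
  have hi : IntegrableOn
      (fun θ => heat θ u * (-σ + 3 * σ * (σ / θ) + σ / θ * (1 - σ / θ) * ‖u‖ ^ 2))
      (Set.Ioi σ) := by
    refine Integrable.mono' (((integrableOn_heat_time hu).mono_set
      (Set.Ioi_subset_Ioi hσ.le)).mul_const (4 * σ + ‖u‖ ^ 2)) (by unfold heat; fun_prop) ?_
    refine (ae_restrict_iff' measurableSet_Ioi).2 (ae_of_all _ fun θ hθ => ?_)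
    have hθ' : σ < θ := hθ
    have hq0 : 0 ≤ σ / θ := div_nonneg hσ.le (hσ.trans hθ').le
    have hq1 : σ / θ ≤ 1 := (div_le_one (hσ.trans hθ')).2 hθ'.le
    rw [Real.norm_eq_abs, abs_mul, abs_of_nonneg (heat_nonneg θ u)]
    refine mul_le_mul_of_nonneg_left ?_ (heat_nonneg θ u)
    have h3 : 0 ≤ σ / θ * (1 - σ / θ) := mul_nonneg hq0 (by linarith)
    have h4 : σ / θ * (1 - σ / θ) ≤ 1 := by nlinarith
    have h5 : 0 ≤ σ / θ * (1 - σ / θ) * ‖u‖ ^ 2 := mul_nonneg h3 (sq_nonneg _)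
    have h6 : σ / θ * (1 - σ / θ) * ‖u‖ ^ 2 ≤ ‖u‖ ^ 2 := by nlinarith [sq_nonneg ‖u‖]
    rw [abs_le]
    constructor <;> nlinarith [mul_nonneg hσ.le hq0, sq_nonneg ‖u‖]
  refine ⟨hi, ?_⟩
  rw [integral_Ioi_of_hasDerivAt_of_tendsto (m := 0)
    (hd σ hσ).continuousAt.continuousWithinAt (fun θ hθ => hd θ (hσ.trans hθ)) hi
    (tendsto_mul_heat σ u)]
  simp

/-- Subtracting the identity of `integral_heat_deriv` makes the second factor affine in `σ / θ`:
the terms quadratic in `σ / θ` cancel, and `a`, `z` enter only through their norms. -/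
lemma lintegral_gauss_norm_sq_mul_inv_eq {σ : ℝ} (hσ : 0 < σ) {z a : E3} (h : a ≠ z) :
    ∫⁻ x, ‖x‖ₑ ^ 2 * ‖x - z‖ₑ⁻¹ ∂gauss a σ = ENNReal.ofReal (2 * Real.pi) *
      ∫⁻ θ in Set.Ioi σ, ENNReal.ofReal (heat θ (a - z) *
        (‖a‖ ^ 2 + 2 * σ + σ / θ * (‖z‖ ^ 2 - ‖a‖ ^ 2))) := by
  have hu : a - z ≠ 0 := sub_ne_zero.2 h
  obtain ⟨hi0, h0⟩ := integral_heat_deriv hσ hu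
  have hi1 : IntegrableOn (fun θ => heat θ (a - z) *
      (‖a‖ ^ 2 + 2 * σ + σ / θ * (‖z‖ ^ 2 - ‖a‖ ^ 2))) (Set.Ioi σ) := by
    refine Integrable.mono' (((integrableOn_heat_time hu).mono_set
      (Set.Ioi_subset_Ioi hσ.le)).mul_const (2 * ‖a‖ ^ 2 + 2 * σ + ‖z‖ ^ 2))
      (by unfold heat; fun_prop) ?_
    refine (ae_restrict_iff' measurableSet_Ioi).2 (ae_of_all _ fun θ hθ => ?_)
    have hθ' : σ < θ := hθ
    have hq0 : 0 ≤ σ / θ := div_nonneg hσ.le (hσ.trans hθ').le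
    have hq1 : σ / θ ≤ 1 := (div_le_one (hσ.trans hθ')).2 hθ'.le
    rw [Real.norm_eq_abs, abs_mul, abs_of_nonneg (heat_nonneg θ _)]
    refine mul_le_mul_of_nonneg_left ?_ (heat_nonneg θ _)
    rw [abs_le]
    constructor <;> nlinarith [sq_nonneg ‖a‖, sq_nonneg ‖z‖, mul_nonneg hq0 (sq_nonneg ‖a‖),
      mul_nonneg hq0 (sq_nonneg ‖z‖)]
  have he : ∀ θ, heat θ (a - z) * (‖a + (σ / θ) • (z - a)‖ ^ 2 + 3 * σ * (1 - σ / θ)) =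
      heat θ (a - z) * (‖a‖ ^ 2 + 2 * σ + σ / θ * (‖z‖ ^ 2 - ‖a‖ ^ 2)) -
      heat θ (a - z) * (-σ + 3 * σ * (σ / θ) + σ / θ * (1 - σ / θ) * ‖a - z‖ ^ 2) := by
    intro θ
    simp only [norm_sq_eq_coord, PiLp.sub_apply, PiLp.add_apply, PiLp.smul_apply, smul_eq_mul]
    ring
  have hi2 : IntegrableOn (fun θ => heat θ (a - z) *
      (‖a + (σ / θ) • (z - a)‖ ^ 2 + 3 * σ * (1 - σ / θ))) (Set.Ioi σ) := by
    simp_rw [he]; exact hi1.sub hi0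
  rw [lintegral_gauss_norm_sq_mul_inv hσ]
  congr 1
  rw [← ofReal_integral_eq_lintegral_ofReal hi2, ← ofReal_integral_eq_lintegral_ofReal hi1]
  · congr 1
    simp_rw [he]
    rw [integral_sub hi1 hi0, h0, sub_zero]
  · refine (ae_restrict_iff' measurableSet_Ioi).2 (ae_of_all _ fun θ hθ => ?_)
    have hθ' : σ < θ := hθ
    have hq0 : 0 ≤ σ / θ := div_nonneg hσ.le (hσ.trans hθ').le
    have hq1 : σ / θ ≤ 1 := (div_le_one (hσ.trans hθ')).2 hθ'.le
    refine mul_nonneg (heat_nonneg _ _) ?_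
    nlinarith [sq_nonneg ‖a‖, sq_nonneg ‖z‖, mul_nonneg hq0 (sq_nonneg ‖z‖)]
  · refine (ae_restrict_iff' measurableSet_Ioi).2 (ae_of_all _ fun θ hθ => ?_)
    have hθ' : σ < θ := hθ
    have hq1 : σ / θ ≤ 1 := (div_le_one (hσ.trans hθ')).2 hθ'.le
    exact mul_nonneg (heat_nonneg _ _) (add_nonneg (sq_nonneg _)
      (mul_nonneg (by positivity) (by linarith)))

/-! ### Smearing a configuration -/

/-- The bilinear energy `∬ |x|² / |x - y| dμ(x) dν(y)`. -/
noncomputable def energy (μ ν : Measure E3) : ℝ≥0∞ :=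
  ∫⁻ x, ‖x‖ₑ ^ 2 * ∫⁻ y, ‖y - x‖ₑ⁻¹ ∂ν ∂μ

lemma pairEnergy_eq_energy (ρ : Measure E3) [SFinite ρ] : pairEnergy ρ = energy ρ ρ := by
  have hk : ∀ x y : E3, (‖x‖ₑ ^ 2 + ‖y‖ₑ ^ 2) / (2 * ‖x - y‖ₑ) =
      2⁻¹ * (‖x‖ₑ ^ 2 * ‖y - x‖ₑ⁻¹) + 2⁻¹ * (‖y‖ₑ ^ 2 * ‖x - y‖ₑ⁻¹) := by
    intro x y
    rw [div_eq_mul_inv, ENNReal.mul_inv (Or.inl two_ne_zero) (Or.inl ENNReal.ofNat_ne_top),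
      enorm_sub_rev y x]
    ring
  have hm : Measurable fun p : E3 × E3 => 2⁻¹ * (‖p.1‖ₑ ^ 2 * ‖p.2 - p.1‖ₑ⁻¹) := by fun_prop
  have hm' : Measurable fun p : E3 × E3 => 2⁻¹ * (‖p.2‖ₑ ^ 2 * ‖p.1 - p.2‖ₑ⁻¹) := by fun_prop
  have h1 : ∫⁻ x, ∫⁻ y, 2⁻¹ * (‖x‖ₑ ^ 2 * ‖y - x‖ₑ⁻¹) ∂ρ ∂ρ = 2⁻¹ * energy ρ ρ := by
    have hmi : Measurable fun x : E3 => ∫⁻ y, ‖y - x‖ₑ⁻¹ ∂ρ :=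
      Measurable.lintegral_prod_right' (f := fun p : E3 × E3 => ‖p.2 - p.1‖ₑ⁻¹) (by fun_prop)
    rw [energy, ← lintegral_const_mul _ (by fun_prop)]
    refine lintegral_congr fun x => ?_
    rw [lintegral_const_mul _ (by fun_prop), lintegral_const_mul _ (by fun_prop)]
  have h2 : ∫⁻ x, ∫⁻ y, 2⁻¹ * (‖y‖ₑ ^ 2 * ‖x - y‖ₑ⁻¹) ∂ρ ∂ρ = 2⁻¹ * energy ρ ρ := by
    rw [lintegral_lintegral_swap hm'.aemeasurable, h1]
  unfold pairEnergy
  simp_rw [hk]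
  simp_rw [fun x => lintegral_add_left (μ := ρ)
    (show Measurable fun y : E3 => 2⁻¹ * (‖x‖ₑ ^ 2 * ‖y - x‖ₑ⁻¹) by fun_prop)]
  rw [lintegral_add_left hm.lintegral_prod_right', h1, h2, ← add_mul, ENNReal.inv_two_add_inv_two,
    one_mul]

lemma betaENN_mul_le (ρ : Measure E3) [IsProbabilityMeasure ρ] (h0 : firstMoment ρ ≠ 0)
    (ht : firstMoment ρ ≠ ∞) : betaENN * firstMoment ρ ≤ energy ρ ρ := by
  rw [← pairEnergy_eq_energy, ← ENNReal.le_div_iff_mul_le (Or.inl h0) (Or.inl ht)]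
  exact sInf_le ⟨ρ, inferInstance, h0, ht, rfl⟩

lemma measurable_lintegral_inv (ν : Measure E3) [SFinite ν] :
    Measurable fun x : E3 => ∫⁻ y, ‖y - x‖ₑ⁻¹ ∂ν :=
  Measurable.lintegral_prod_right' (f := fun p : E3 × E3 => ‖p.2 - p.1‖ₑ⁻¹) (by fun_prop)

lemma energy_smul_sum {ι : Type*} (s : Finset ι) (c : ι → ℝ≥0∞) (μ : ι → Measure E3)
    [∀ i, SFinite (μ i)] :
    energy (∑ i ∈ s, c i • μ i) (∑ i ∈ s, c i • μ i) =
      ∑ i ∈ s, ∑ j ∈ s, c i * c j * energy (μ i) (μ j) := by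
  have h : ∀ j, Measurable fun x : E3 => ‖x‖ₑ ^ 2 * ∫⁻ y, ‖y - x‖ₑ⁻¹ ∂μ j := fun j =>
    Measurable.mul (by fun_prop) (measurable_lintegral_inv (μ j))
  simp only [energy, lintegral_finsetSum_measure, lintegral_smul_measure, smul_eq_mul,
    Finset.mul_sum]
  refine Finset.sum_congr rfl fun i _ => ?_
  simp_rw [mul_left_comm _ (c _)]
  rw [lintegral_finsetSum _ fun j _ => (h j).const_mul _, Finset.mul_sum]
  refine Finset.sum_congr rfl fun j _ => ?_
  rw [lintegral_const_mul _ (h j), mul_assoc]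

lemma firstMoment_smul_sum {ι : Type*} (s : Finset ι) (c : ι → ℝ≥0∞) (μ : ι → Measure E3) :
    firstMoment (∑ i ∈ s, c i • μ i) = ∑ i ∈ s, c i * firstMoment (μ i) := by
  simp [firstMoment, lintegral_finsetSum_measure]

/-- A point mass at `a`, smeared into a Gaussian of standard deviation `t |a|`. -/
noncomputable def smear (t : ℝ) (a : E3) : Measure E3 :=
  if a = 0 then Measure.dirac 0 else gauss a (t ^ 2 * ‖a‖ ^ 2)

lemma smear_zero (t : ℝ) : smear t 0 = Measure.dirac 0 := if_pos rfl

lemma smear_of_ne {a : E3} (h : a ≠ 0) (t : ℝ) : smear t a = gauss a (t ^ 2 * ‖a‖ ^ 2) :=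
  if_neg h

lemma smear_var_pos {t : ℝ} (ht : 0 < t) {a : E3} (h : a ≠ 0) : 0 < t ^ 2 * ‖a‖ ^ 2 := by
  have := norm_pos_iff.2 h; positivity

lemma isProbabilityMeasure_smear {t : ℝ} (ht : 0 < t) (a : E3) :
    IsProbabilityMeasure (smear t a) := by
  rcases eq_or_ne a 0 with rfl | h
  · rw [smear_zero]; infer_instance
  · rw [smear_of_ne h]; exact isProbabilityMeasure_gauss a (smear_var_pos ht h)

lemma lintegral_smear_inv_le {t : ℝ} (ht : 0 < t) (a z : E3) :
    ∫⁻ x, ‖x - z‖ₑ⁻¹ ∂smear t a ≤ ‖a - z‖ₑ⁻¹ := by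
  rcases eq_or_ne a 0 with rfl | h
  · rw [smear_zero, lintegral_dirac' _ (by fun_prop)]
  · rw [smear_of_ne h]; exact lintegral_gauss_inv_le (smear_var_pos ht h) z a

lemma enorm_le_firstMoment_smear {t : ℝ} (ht : 0 < t) (a : E3) :
    ‖a‖ₑ ≤ firstMoment (smear t a) := by
  rcases eq_or_ne a 0 with rfl | h
  · simp
  · rw [smear_of_ne h]; exact enorm_le_lintegral_gauss a (smear_var_pos ht h)

lemma firstMoment_smear_ne_top {t : ℝ} (ht : 0 < t) (a : E3) :
    firstMoment (smear t a) ≠ ∞ := by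
  rcases eq_or_ne a 0 with rfl | h
  · rw [smear_zero, firstMoment, lintegral_dirac' _ (by fun_prop)]; simp
  · rw [smear_of_ne h]; exact lintegral_enorm_gauss_ne_top a (smear_var_pos ht h)

lemma lintegral_smear_norm_sq_mul_inv {t : ℝ} (ht : 0 < t) {a z : E3} (h : a ≠ z) :
    ∫⁻ x, ‖x‖ₑ ^ 2 * ‖x - z‖ₑ⁻¹ ∂smear t a = ENNReal.ofReal (2 * Real.pi) *
      ∫⁻ θ in Set.Ioi (0 : ℝ), ENNReal.ofReal (heat θ (a - z) *
        if t ^ 2 * ‖a‖ ^ 2 < θ then ‖a‖ ^ 2 + 2 * (t ^ 2 * ‖a‖ ^ 2) +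
          t ^ 2 * ‖a‖ ^ 2 / θ * (‖z‖ ^ 2 - ‖a‖ ^ 2) else 0) := by
  rcases eq_or_ne a 0 with rfl | h0
  · rw [smear_zero, lintegral_dirac' _ (by fun_prop)]
    simp
  · have hσ := smear_var_pos ht h0
    rw [smear_of_ne h0, lintegral_gauss_norm_sq_mul_inv_eq hσ h]
    generalize t ^ 2 * ‖a‖ ^ 2 = σ at *
    congr 1
    rw [← lintegral_indicator measurableSet_Ioi, ← lintegral_indicator measurableSet_Ioi]
    refine lintegral_congr fun θ => ?_
    by_cases h1 : σ < θ
    · simp [h1, hσ.trans h1]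
    · by_cases h2 : 0 < θ <;> simp [h1, h2]

/-- For each `θ`, the contributions of a pair of smeared points to the energy add up to at most
`(1 + 2 t²) (|a|² + |z|²)`: where both are present, the terms that are not of this form add up to
`-t² (|a|² - |z|²)² / θ`. -/
lemma smear_pair_pointwise {s A B θ : ℝ} (hs : 0 < s) (hA : 0 ≤ A) (hB : 0 ≤ B) (hθ : 0 < θ) :
    (if s * A < θ then A + 2 * (s * A) + s * A / θ * (B - A) else 0) +
      (if s * B < θ then B + 2 * (s * B) + s * B / θ * (A - B) else 0) ≤
      (1 + 2 * s) * (A + B) := by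
  wlog hAB : A ≤ B generalizing A B
  · rw [add_comm A B, add_comm]
    exact this hB hA (le_of_not_ge hAB)
  have hAs := mul_nonneg hs.le hA
  have hBs := mul_nonneg hs.le hB
  by_cases h2 : s * B < θ
  · have h1 : s * A < θ := (mul_le_mul_of_nonneg_left hAB hs.le).trans_lt h2
    rw [if_pos h1, if_pos h2]
    have : s * A / θ * (B - A) + s * B / θ * (A - B) = -(s / θ * (A - B) ^ 2) := by ring
    have h3 : 0 ≤ s / θ * (A - B) ^ 2 := by positivity
    nlinarith
  · rw [if_neg h2]
    by_cases h1 : s * A < θ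
    · rw [if_pos h1]
      have h3 : s * A / θ ≤ 1 := (div_le_one hθ).2 h1.le
      nlinarith [mul_le_mul_of_nonneg_right h3 (sub_nonneg.2 hAB)]
    · rw [if_neg h1]
      nlinarith

/-- Each of the two integrals may exceed its value for point masses by more than the factor
`1 + 2 t²`; only their sum, in which the errors of `smear_pair_pointwise` cancel, does not. -/
lemma smear_pair_le {t : ℝ} (ht : 0 < t) {a z : E3} (h : a ≠ z) :
    ∫⁻ x, ‖x‖ₑ ^ 2 * ‖x - z‖ₑ⁻¹ ∂smear t a + ∫⁻ x, ‖x‖ₑ ^ 2 * ‖x - a‖ₑ⁻¹ ∂smear t z ≤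
      ENNReal.ofReal ((1 + 2 * t ^ 2) * pairTerm a z) := by
  have hn : 0 < ‖a - z‖ := norm_pos_iff.2 (sub_ne_zero.2 h)
  have hm : Measurable fun θ => ENNReal.ofReal (heat θ (a - z) *
      if t ^ 2 * ‖a‖ ^ 2 < θ then ‖a‖ ^ 2 + 2 * (t ^ 2 * ‖a‖ ^ 2) +
        t ^ 2 * ‖a‖ ^ 2 / θ * (‖z‖ ^ 2 - ‖a‖ ^ 2) else 0) := by
    refine Measurable.ennreal_ofReal (Measurable.mul (by unfold heat; fun_prop) ?_)
    exact Measurable.ite measurableSet_Ioi (by fun_prop) measurable_const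
  rw [lintegral_smear_norm_sq_mul_inv ht h, lintegral_smear_norm_sq_mul_inv ht h.symm, ← mul_add,
    ← lintegral_add_left hm]
  calc _ ≤ ENNReal.ofReal (2 * Real.pi) * ∫⁻ θ in Set.Ioi (0 : ℝ),
        ENNReal.ofReal (heat θ (a - z)) *
          ENNReal.ofReal ((1 + 2 * t ^ 2) * (‖a‖ ^ 2 + ‖z‖ ^ 2)) := by
        refine mul_le_mul' le_rfl (setLIntegral_mono' measurableSet_Ioi fun θ hθ => ?_)
        have hθ' : 0 < θ := hθ
        have hnn : ∀ A B : ℝ, 0 ≤ A → 0 ≤ B → 0 ≤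
            (if t ^ 2 * A < θ then A + 2 * (t ^ 2 * A) + t ^ 2 * A / θ * (B - A) else 0) := by
          intro A B hA hB
          split_ifs with h1
          · have h3 : t ^ 2 * A / θ ≤ 1 := (div_le_one hθ').2 h1.le
            have h4 : 0 ≤ t ^ 2 * A / θ := by positivity
            nlinarith [mul_nonneg h4 hB, mul_nonneg (sub_nonneg.2 h3) hA,
              mul_nonneg (sq_nonneg t) hA]
          · exact le_rfl
        rw [heat_sub_comm θ z a, ← ENNReal.ofReal_mul (heat_nonneg _ _), ← ENNReal.ofReal_add
          (mul_nonneg (heat_nonneg _ _) (hnn _ _ (sq_nonneg _) (sq_nonneg _)))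
          (mul_nonneg (heat_nonneg _ _) (hnn _ _ (sq_nonneg _) (sq_nonneg _))), ← mul_add]
        exact ENNReal.ofReal_le_ofReal (mul_le_mul_of_nonneg_left
          (smear_pair_pointwise (by positivity) (sq_nonneg _) (sq_nonneg _) hθ')
          (heat_nonneg _ _))
    _ = _ := by
        rw [lintegral_mul_const _ (by unfold heat; fun_prop), ← mul_assoc,
          lintegral_heat_time (sub_ne_zero.2 h), ← ofReal_norm, ← ENNReal.ofReal_inv_of_pos hn,
          ← ENNReal.ofReal_mul (by positivity), pairTerm]
        congr 1
        field_simp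

lemma lintegral_heat_zero {σ : ℝ} (hσ : 0 < σ) :
    ENNReal.ofReal (2 * Real.pi) * ∫⁻ θ in Set.Ioi σ, ENNReal.ofReal (heat (θ + σ) 0) =
      ENNReal.ofReal (1 / √(Real.pi * σ)) := by
  have hp := Real.pi_pos
  have hi := integrableOn_Ioi_rpow_of_lt (a := -(3 : ℝ) / 2) (by norm_num)
    (show 0 < σ + σ by positivity)
  have hI := integral_Ioi_rpow_of_lt (a := -(3 : ℝ) / 2) (by norm_num)
    (show 0 < σ + σ by positivity)
  have h1 : ∫⁻ θ in Set.Ioi σ, ENNReal.ofReal (heat (θ + σ) 0) =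
      ∫⁻ θ in Set.Ioi (σ + σ), ENNReal.ofReal (heat θ 0) := by
    have := (measurePreserving_add_right volume σ).setLIntegral_comp_preimage_emb
      (measurableEmbedding_addRight σ) (fun θ => ENNReal.ofReal (heat θ 0)) (Set.Ioi (σ + σ))
    simpa using this
  have h2 : ∫⁻ θ in Set.Ioi (σ + σ), ENNReal.ofReal (heat θ 0) =
      ∫⁻ θ in Set.Ioi (σ + σ), ENNReal.ofReal ((√(2 * Real.pi) ^ 3)⁻¹ * θ ^ (-(3 : ℝ) / 2)) := by
    refine setLIntegral_congr_fun measurableSet_Ioi fun θ hθ => ?_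
    have hθ' : 0 < θ := lt_trans (by positivity) hθ
    rw [heat_eq_rpow hθ']
    simp
  rw [h1, h2, ← ofReal_integral_eq_lintegral_ofReal (hi.const_mul _)
    ((ae_restrict_iff' measurableSet_Ioi).2 (ae_of_all _ fun θ hθ => by
      have hθ' : 0 < θ := lt_trans (by positivity) hθ
      simp only [Pi.zero_apply]
      positivity)), integral_const_mul, hI,
    ← ENNReal.ofReal_mul (by positivity)]
  congr 1
  have e1 : (σ + σ) ^ (-(3 : ℝ) / 2 + 1) = (√(2 * σ))⁻¹ := by
    rw [← two_mul, Real.sqrt_eq_rpow, ← Real.rpow_neg (by positivity)]; norm_num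
  rw [e1, Real.sqrt_mul zero_le_two, Real.sqrt_mul zero_le_two, Real.sqrt_mul hp.le]
  have h4 : √2 ^ 2 = 2 := Real.sq_sqrt zero_le_two
  have h5 : √Real.pi ^ 2 = Real.pi := Real.sq_sqrt hp.le
  have hs : 0 < √σ := Real.sqrt_pos.2 hσ
  have hq : 0 < √Real.pi := Real.sqrt_pos.2 hp
  nth_rewrite 1 [← h5]
  norm_num
  field_simp
  nlinarith

/-- Smearing makes the self-energy of a point finite. -/
lemma energy_smear_self_le {t : ℝ} (ht : 0 < t) (a : E3) :
    energy (smear t a) (smear t a) ≤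
      ENNReal.ofReal (1 / √Real.pi * (1 / t + 3 * t) * ‖a‖) := by
  have hp := Real.pi_pos
  rcases eq_or_ne a 0 with rfl | h0
  · rw [smear_zero, energy, lintegral_dirac]
    simp
  have hσ := smear_var_pos ht h0
  have hn : 0 < ‖a‖ := norm_pos_iff.2 h0
  rw [smear_of_ne h0, energy]
  have hrt : √(Real.pi * (t ^ 2 * ‖a‖ ^ 2)) = √Real.pi * (t * ‖a‖) := by
    rw [Real.sqrt_mul hp.le, ← mul_pow, Real.sqrt_sq (by positivity)]
  have hfin : 1 / √Real.pi * (1 / t + 3 * t) * ‖a‖ =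
      1 / √(Real.pi * (t ^ 2 * ‖a‖ ^ 2)) * (‖a‖ ^ 2 + 3 * (t ^ 2 * ‖a‖ ^ 2)) := by
    rw [hrt]
    have := Real.sqrt_pos.2 hp
    field_simp
  rw [hfin]
  generalize t ^ 2 * ‖a‖ ^ 2 = σ at *
  have := sFinite_gauss a σ
  have hm : Measurable fun p : E3 × ℝ => ‖p.1‖ₑ ^ 2 * ENNReal.ofReal (heat p.2 (p.1 - a)) := by
    unfold heat; fun_prop
  have h1 : ∀ x : E3, ‖x‖ₑ ^ 2 * ∫⁻ y, ‖y - x‖ₑ⁻¹ ∂gauss a σ = ENNReal.ofReal (2 * Real.pi) *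
      ∫⁻ θ in Set.Ioi σ, ‖x‖ₑ ^ 2 * ENNReal.ofReal (heat θ (x - a)) := by
    intro x
    rw [lintegral_gauss_inv hσ, mul_left_comm, lintegral_const_mul _ (by unfold heat; fun_prop)]
    simp_rw [heat_sub_comm _ a x]
  simp_rw [h1]
  rw [lintegral_const_mul _ hm.lintegral_prod_right', lintegral_lintegral_swap hm.aemeasurable]
  calc _ ≤ ENNReal.ofReal (2 * Real.pi) * ∫⁻ θ in Set.Ioi σ, ENNReal.ofReal (heat (θ + σ) 0) *
        ENNReal.ofReal (‖a‖ ^ 2 + 3 * σ) := by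
        refine mul_le_mul' le_rfl (setLIntegral_mono' measurableSet_Ioi fun θ hθ => ?_)
        have hθ' : 0 < θ := hσ.trans hθ
        rw [lintegral_gauss_mul_heat hθ' hσ a a (by fun_prop), sub_self, smul_zero, add_zero,
          lintegral_norm_sq_gauss a (by positivity)]
        refine mul_le_mul' le_rfl (ENNReal.ofReal_le_ofReal ?_)
        have : θ * σ / (θ + σ) ≤ σ := by
          rw [div_le_iff₀ (by positivity)]; nlinarith
        linarith
    _ = _ := by
        rw [lintegral_mul_const _ (by unfold heat; fun_prop), ← mul_assoc, lintegral_heat_zero hσ,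
          ← ENNReal.ofReal_mul (by positivity)]

/-! ### The lower bound on `α_N` -/

lemma energy_smear_le {t : ℝ} (ht : 0 < t) (a z : E3) :
    energy (smear t a) (smear t z) ≤ ∫⁻ x, ‖x‖ₑ ^ 2 * ‖x - z‖ₑ⁻¹ ∂smear t a := by
  refine lintegral_mono fun x => mul_le_mul' le_rfl ?_
  rw [enorm_sub_rev x z]
  exact lintegral_smear_inv_le ht z x

lemma sum_energy_smear_le {N : ℕ} {x : Fin N → E3} (hx : Function.Injective x) {t : ℝ}
    (ht : 0 < t) :
    ∑ i, ∑ j, energy (smear t (x i)) (smear t (x j)) ≤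
      ENNReal.ofReal (1 / √Real.pi * (1 / t + 3 * t) * ∑ i, ‖x i‖ +
        (1 + 2 * t ^ 2) * pairSum x / 2) := by
  set F : Fin N → Fin N → ℝ≥0∞ := fun i j =>
    if i = j then 0 else ∫⁻ y, ‖y‖ₑ ^ 2 * ‖y - x j‖ₑ⁻¹ ∂smear t (x i) with hF
  have hp := Real.pi_pos
  have hpair : ∀ i j, F i j + F j i ≤
      ENNReal.ofReal ((1 + 2 * t ^ 2) * pairTerm (x i) (x j)) := by
    intro i j
    by_cases hij : i = j
    · simp [hF, hij]
    · simp only [hF, hij, Ne.symm hij, if_false]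
      exact smear_pair_le ht (hx.ne hij)
  have hsum : ∑ i, ∑ j, F i j ≤ ENNReal.ofReal ((1 + 2 * t ^ 2) * pairSum x / 2) := by
    rw [ENNReal.ofReal_div_of_pos zero_lt_two, ENNReal.le_div_iff_mul_le (by simp) (by simp),
      ENNReal.ofReal_ofNat, mul_two]
    nth_rewrite 2 [Finset.sum_comm]
    simp_rw [← Finset.sum_add_distrib]
    rw [pairSum, Finset.mul_sum, ENNReal.ofReal_sum_of_nonneg fun i _ => mul_nonneg
      (by positivity) (Finset.sum_nonneg fun j _ => pairTerm_nonneg _ _)]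
    refine Finset.sum_le_sum fun i _ => ?_
    rw [Finset.mul_sum, ENNReal.ofReal_sum_of_nonneg fun j _ => mul_nonneg
      (by positivity) (pairTerm_nonneg _ _)]
    exact Finset.sum_le_sum fun j _ => hpair i j
  have hself : ∑ i, energy (smear t (x i)) (smear t (x i)) ≤
      ENNReal.ofReal (1 / √Real.pi * (1 / t + 3 * t) * ∑ i, ‖x i‖) := by
    rw [Finset.mul_sum, ENNReal.ofReal_sum_of_nonneg fun i _ => by positivity]
    exact Finset.sum_le_sum fun i _ => energy_smear_self_le ht (x i)
  rw [ENNReal.ofReal_add (mul_nonneg (by positivity) (Finset.sum_nonneg fun _ _ => norm_nonneg _))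
    (div_nonneg (mul_nonneg (by positivity) (pairSum_nonneg x)) zero_le_two)]
  refine le_trans ?_ (add_le_add hself hsum)
  rw [← Finset.sum_add_distrib]
  refine Finset.sum_le_sum fun i _ => ?_
  rw [← Finset.add_sum_erase _ _ (Finset.mem_univ i)]
  refine add_le_add le_rfl ?_
  rw [← Finset.add_sum_erase _ (F i) (Finset.mem_univ i)]
  refine le_add_left (Finset.sum_le_sum fun j hj => ?_)
  simp only [hF, (Finset.ne_of_mem_erase hj).symm, if_false]
  exact energy_smear_le ht _ _

/-- The variational inequality for the smeared empirical measure of a configuration. -/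
lemma betaENN_mul_sum_le {N : ℕ} (hN : 2 ≤ N) {x : Fin N → E3} (hx : Function.Injective x)
    {t : ℝ} (ht : 0 < t) :
    betaENN * (N * ∑ i, ‖x i‖ₑ) ≤
      ENNReal.ofReal (1 / √Real.pi * (1 / t + 3 * t) * ∑ i, ‖x i‖ +
        (1 + 2 * t ^ 2) * pairSum x / 2) := by
  have hN0 : (N : ℝ≥0∞) ≠ 0 := Nat.cast_ne_zero.2 (by omega)
  have hNt : (N : ℝ≥0∞) ≠ ∞ := ENNReal.natCast_ne_top N
  have hprob : ∀ i, IsProbabilityMeasure (smear t (x i)) := fun i =>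
    isProbabilityMeasure_smear ht (x i)
  set ρ : Measure E3 := ∑ i, (N : ℝ≥0∞)⁻¹ • smear t (x i) with hρ
  have hρp : IsProbabilityMeasure ρ := ⟨by
    rw [hρ, Measure.finsetSum_apply]
    simp [ENNReal.mul_inv_cancel hN0 hNt]⟩
  have hM : firstMoment ρ = (N : ℝ≥0∞)⁻¹ * ∑ i, firstMoment (smear t (x i)) := by
    rw [hρ, firstMoment_smul_sum, Finset.mul_sum]
  have hMx : ∑ i, ‖x i‖ₑ ≤ ∑ i, firstMoment (smear t (x i)) :=
    Finset.sum_le_sum fun i _ => enorm_le_firstMoment_smear ht (x i)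
  have hMt : firstMoment ρ ≠ ∞ := by
    rw [hM]
    exact ENNReal.mul_ne_top (ENNReal.inv_ne_top.2 hN0)
      (ENNReal.sum_ne_top.2 fun i _ => firstMoment_smear_ne_top ht (x i))
  have hM0 : firstMoment ρ ≠ 0 := by
    rw [hM]
    refine mul_ne_zero (ENNReal.inv_ne_zero.2 hNt) fun h => ?_
    have h1 : ∑ i, ‖x i‖ₑ = 0 := le_antisymm (h ▸ hMx) zero_le
    have h2 := sum_norm_pos hN hx
    have h3 : ∑ i, ‖x i‖ = 0 := Finset.sum_eq_zero fun i hi => by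
      have := (Finset.sum_eq_zero_iff.1 h1) i hi
      simpa using this
    linarith
  have h := betaENN_mul_le ρ hM0 hMt
  rw [hM] at h
  nth_rewrite 1 [hρ] at h
  nth_rewrite 1 [hρ] at h
  rw [energy_smul_sum] at h
  simp_rw [← Finset.mul_sum] at h
  have h2 : betaENN * (N * ∑ i, firstMoment (smear t (x i))) ≤
      ∑ i, ∑ j, energy (smear t (x i)) (smear t (x j)) := by
    have hNN : (N : ℝ≥0∞) * (N : ℝ≥0∞)⁻¹ = 1 := ENNReal.mul_inv_cancel hN0 hNt
    calc _ = (N : ℝ≥0∞) * N * (betaENN * ((N : ℝ≥0∞)⁻¹ * ∑ i, firstMoment (smear t (x i)))) := by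
          rw [show (N : ℝ≥0∞) * N * (betaENN * ((N : ℝ≥0∞)⁻¹ *
            ∑ i, firstMoment (smear t (x i)))) = betaENN * (N * (N * (N : ℝ≥0∞)⁻¹) *
            ∑ i, firstMoment (smear t (x i))) by ring, hNN, mul_one]
      _ ≤ (N : ℝ≥0∞) * N * _ := mul_le_mul' le_rfl h
      _ = ((N : ℝ≥0∞) * (N : ℝ≥0∞)⁻¹) * ((N : ℝ≥0∞) * (N : ℝ≥0∞)⁻¹) *
          ∑ i, ∑ j, energy (smear t (x i)) (smear t (x j)) := by ring
      _ = _ := by rw [hNN, one_mul, one_mul]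
  exact (mul_le_mul' le_rfl (mul_le_mul' le_rfl hMx)).trans
    (h2.trans (sum_energy_smear_le hx ht))

/-- The choice `t = (4π r²)^{-1/2}` with `r³ = β N / 6` in the previous inequality; that it
suffices is the inequality `π ≥ 3`. -/
lemma sub_mul_le_pairSum (hβ : betaENN ≠ ∞) (hβ0 : 0 < beta) {N : ℕ} (hN : 2 ≤ N)
    {x : Fin N → E3} (hx : Function.Injective x) :
    2 * ((beta * N - 3 * (beta * N / 6) ^ ((1 : ℝ) / 3)) * ∑ i, ‖x i‖) ≤ pairSum x := by
  have hN0 : (0 : ℝ) < N := by exact_mod_cast (show 0 < N by omega)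
  have hB : 0 < beta * N := mul_pos hβ0 hN0
  set r := (beta * N / 6) ^ ((1 : ℝ) / 3) with hr
  have hr0 : 0 < r := Real.rpow_pos_of_pos (by positivity) _
  have hr3 : 6 * r ^ 3 = beta * N := by
    rw [hr, ← Real.rpow_mul_natCast (by positivity)]
    norm_num
    ring
  have hq : 0 < √Real.pi := Real.sqrt_pos.2 Real.pi_pos
  set C := 1 / √Real.pi with hC
  have hC0 : 0 < C := by positivity
  have hC2 : C ^ 2 ≤ 1 / 3 := by
    rw [hC, div_pow, Real.sq_sqrt Real.pi_pos.le, one_pow]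
    exact one_div_le_one_div_of_le (by norm_num) Real.pi_gt_three.le
  have ht : 0 < C / (2 * r) := by positivity
  have h := betaENN_mul_sum_le hN hx ht
  have hS0 := sum_norm_pos hN hx
  set S := ∑ i, ‖x i‖ with hS
  have hL : betaENN * (N * ∑ i, ‖x i‖ₑ) = ENNReal.ofReal (beta * N * S) := by
    rw [beta, hS, mul_assoc, ENNReal.ofReal_mul ENNReal.toReal_nonneg, ENNReal.ofReal_toReal hβ,
      ENNReal.ofReal_mul hN0.le, ENNReal.ofReal_natCast,
      ENNReal.ofReal_sum_of_nonneg fun _ _ => norm_nonneg _]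
    simp only [ofReal_norm]
  rw [hL, ENNReal.ofReal_le_ofReal_iff (add_nonneg (by positivity)
    (div_nonneg (mul_nonneg (by positivity) (pairSum_nonneg x)) zero_le_two))] at h
  have e1 : C * (1 / (C / (2 * r)) + 3 * (C / (2 * r))) = 2 * r + 3 * C ^ 2 / (2 * r) := by
    field_simp
  have e2 : 2 * (C / (2 * r)) ^ 2 = C ^ 2 / (2 * r ^ 2) := by field_simp
  rw [e1, e2] at h
  have h3 : (1 + C ^ 2 / (2 * r ^ 2)) * (2 * ((beta * N - 3 * r) * S)) ≤
      (1 + C ^ 2 / (2 * r ^ 2)) * pairSum x := by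
    have e3 : (1 + C ^ 2 / (2 * r ^ 2)) * (beta * N - 3 * r) =
        beta * N - (2 * r + 3 * C ^ 2 / (2 * r)) - r * (1 - 3 * C ^ 2) := by
      rw [← hr3]; field_simp; ring
    have h4 : 0 ≤ r * (1 - 3 * C ^ 2) := mul_nonneg hr0.le (by linarith)
    have h5 : (1 + C ^ 2 / (2 * r ^ 2)) * (beta * N - 3 * r) * S ≤
        (beta * N - (2 * r + 3 * C ^ 2 / (2 * r))) * S :=
      mul_le_mul_of_nonneg_right (by rw [e3]; linarith) hS0.le
    linarith
  exact le_of_mul_le_mul_left h3 (by positivity)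

theorem le_alpha_of_beta (hβ : betaENN ≠ ∞) (hβ0 : 0 < beta) {N : ℕ} (hN : 2 ≤ N) :
    (N : ℝ) / ((N : ℝ) - 1) *
      (beta - 3 * (beta / 6) ^ ((1 : ℝ) / 3) * (N : ℝ) ^ (-((2 : ℝ) / 3))) ≤ alpha N := by
  refine le_alpha hN fun x hx => le_of_eq_of_le ?_ (sub_mul_le_pairSum hβ hβ0 hN hx)
  have hN2 : (2 : ℝ) ≤ N := by exact_mod_cast hN
  have hN0 : (0 : ℝ) < N := by linarith
  have hN1 : (N : ℝ) - 1 ≠ 0 := by linarith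
  have e : (beta * N / 6) ^ ((1 : ℝ) / 3) =
      (beta / 6) ^ ((1 : ℝ) / 3) * ((N : ℝ) * (N : ℝ) ^ (-((2 : ℝ) / 3))) := by
    rw [mul_div_right_comm, Real.mul_rpow (by positivity) hN0.le, ← Real.rpow_one_add' hN0.le
      (by norm_num)]
    norm_num
  rw [e]
  field_simp

theorem tendsto_alpha (hβ : betaENN ≠ ∞) (hβ0 : 0 < beta) : Tendsto alpha atTop (𝓝 beta) := by
  have h1 : Tendsto (fun N : ℕ => (N : ℝ) / ((N : ℝ) - 1)) atTop (𝓝 1) := by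
    have h := (tendsto_const_nhds (x := (1 : ℝ))).sub
      (tendsto_one_div_atTop_nhds_zero_nat (𝕜 := ℝ))
    rw [sub_zero] at h
    have h' := h.inv₀ one_ne_zero
    rw [inv_one] at h'
    refine h'.congr' ?_
    filter_upwards [eventually_ge_atTop 2] with N hN
    have hN2 : (2 : ℝ) ≤ N := by exact_mod_cast hN
    have : (N : ℝ) - 1 ≠ 0 := by linarith
    field_simp
  have h2 : Tendsto (fun N : ℕ => (N : ℝ) ^ (-((2 : ℝ) / 3))) atTop (𝓝 0) :=
    (tendsto_rpow_neg_atTop (by norm_num)).comp tendsto_natCast_atTop_atTop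
  have h3 := h1.mul ((tendsto_const_nhds (x := beta)).sub
    (h2.const_mul (3 * (beta / 6) ^ ((1 : ℝ) / 3))))
  rw [mul_zero, sub_zero, one_mul] at h3
  refine tendsto_of_tendsto_of_tendsto_of_le_of_le' h3 tendsto_const_nhds ?_ ?_
  · filter_upwards [eventually_ge_atTop 2] with N hN using le_alpha_of_beta hβ hβ0 hN
  · filter_upwards [eventually_ge_atTop 2] with N hN using alpha_le_beta hN hβ

/-! ### Uniform measures on spheres and Newton's theorem -/

lemma measurePreserving_coords :
    MeasurePreserving (fun x : E3 => ((x 0, (x 1, x 2)) : ℝ × ℝ × ℝ)) := by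
  have h1 := EuclideanSpace.volume_preserving_symm_measurableEquiv_toLp (Fin 3)
  have h2 := volume_preserving_piFinSuccAbove (fun _ : Fin 3 => ℝ) 0
  have h3 := (MeasurePreserving.id (volume : Measure ℝ)).prod
    (volume_preserving_finTwoArrow ℝ)
  exact h3.comp (h2.comp h1)

lemma lintegral_radial_two {g : ℝ → ℝ≥0∞} (hg : Measurable g) :
    ∫⁻ p : ℝ × ℝ, g (p.1 ^ 2 + p.2 ^ 2) =
      ENNReal.ofReal (2 * Real.pi) * ∫⁻ ρ in Set.Ioi (0 : ℝ), ENNReal.ofReal ρ * g (ρ ^ 2) := by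
  have hp := Real.pi_pos
  rw [← lintegral_comp_polarCoord_symm, polarCoord_target, Measure.volume_eq_prod,
    ← Measure.prod_restrict]
  have h : ∀ p : ℝ × ℝ, ENNReal.ofReal p.1 • g ((polarCoord.symm p).1 ^ 2 +
      (polarCoord.symm p).2 ^ 2) = (ENNReal.ofReal p.1 * g (p.1 ^ 2)) * 1 := by
    intro p
    rw [polarCoord_symm_apply, mul_one, smul_eq_mul]
    congr 2
    simp only
    nlinarith [Real.sin_sq_add_cos_sq p.2]
  simp_rw [h]
  rw [lintegral_prod_mul (f := fun ρ => ENNReal.ofReal ρ * g (ρ ^ 2)) (g := fun _ => 1)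
    (by fun_prop) (by fun_prop), mul_comm]
  congr 1
  rw [setLIntegral_const, one_mul, Real.volume_Ioo]
  congr 1
  ring

/-- Polar coordinates in the half plane `p.2 > 0`. -/
lemma lintegral_half_plane {A B : ℝ → ℝ≥0∞} (hA : Measurable A) (hB : Measurable B) :
    ∫⁻ p : ℝ × ℝ, (if 0 < p.2 then ENNReal.ofReal p.2 *
      (A (p.1 ^ 2 + p.2 ^ 2) * B (p.1 / √(p.1 ^ 2 + p.2 ^ 2))) else 0) =
      (∫⁻ r in Set.Ioi (0 : ℝ), ENNReal.ofReal (r ^ 2) * A (r ^ 2)) *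
        ∫⁻ φ in Set.Ioo 0 Real.pi, ENNReal.ofReal (Real.sin φ) * B (Real.cos φ) := by
  have hp := Real.pi_pos
  rw [← lintegral_comp_polarCoord_symm, polarCoord_target]
  have h : ∀ p ∈ Set.Ioi (0 : ℝ) ×ˢ Set.Ioo (-Real.pi) Real.pi,
      ENNReal.ofReal p.1 • (if 0 < (polarCoord.symm p).2 then
        ENNReal.ofReal (polarCoord.symm p).2 *
        (A ((polarCoord.symm p).1 ^ 2 + (polarCoord.symm p).2 ^ 2) *
          B ((polarCoord.symm p).1 /
            √((polarCoord.symm p).1 ^ 2 + (polarCoord.symm p).2 ^ 2))) else 0) =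
      (ENNReal.ofReal (p.1 ^ 2) * A (p.1 ^ 2)) * (Set.Ioo 0 Real.pi).indicator
        (fun φ => ENNReal.ofReal (Real.sin φ) * B (Real.cos φ)) p.2 := by
    rintro ⟨r, φ⟩ ⟨hr, hφ⟩
    have hr' : 0 < r := hr
    rw [polarCoord_symm_apply]
    simp only
    have e : (r * Real.cos φ) ^ 2 + (r * Real.sin φ) ^ 2 = r ^ 2 := by
      nlinarith [Real.sin_sq_add_cos_sq φ]
    rw [e, Real.sqrt_sq hr'.le, mul_div_cancel_left₀ _ hr'.ne']
    by_cases h1 : 0 < φ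
    · have hs : 0 < Real.sin φ := Real.sin_pos_of_pos_of_lt_pi h1 hφ.2
      rw [if_pos (mul_pos hr' hs), Set.indicator_of_mem (show φ ∈ Set.Ioo 0 Real.pi from
        ⟨h1, hφ.2⟩), ENNReal.ofReal_mul hr'.le, sq, ENNReal.ofReal_mul hr'.le, smul_eq_mul]
      ring
    · have hs : Real.sin φ ≤ 0 :=
        Real.sin_nonpos_of_nonpos_of_neg_pi_le (not_lt.1 h1) hφ.1.le
      rw [if_neg (not_lt.2 (mul_nonpos_of_nonneg_of_nonpos hr'.le hs)),
        Set.indicator_of_notMem (fun h2 => h1 h2.1), smul_zero, mul_zero]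
  rw [setLIntegral_congr_fun (measurableSet_Ioi.prod measurableSet_Ioo) h,
    Measure.volume_eq_prod, ← Measure.prod_restrict, lintegral_prod_mul
    (f := fun r => ENNReal.ofReal (r ^ 2) * A (r ^ 2))
    (g := (Set.Ioo 0 Real.pi).indicator fun φ => ENNReal.ofReal (Real.sin φ) * B (Real.cos φ))
    (by fun_prop)
    (Measurable.aemeasurable (Measurable.indicator (by fun_prop) measurableSet_Ioo)),
    lintegral_indicator measurableSet_Ioo, Measure.restrict_restrict measurableSet_Ioo,
    Set.inter_eq_left.2 (Set.Ioo_subset_Ioo_left (by linarith))]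

/-- Integration in spherical coordinates of a function of `|x|` and of the polar angle. -/
lemma lintegral_zonal {A B : ℝ → ℝ≥0∞} (hA : Measurable A) (hB : Measurable B) :
    ∫⁻ x : E3, A (‖x‖ ^ 2) * B (x 0 / ‖x‖) = ENNReal.ofReal (2 * Real.pi) *
      (∫⁻ r in Set.Ioi (0 : ℝ), ENNReal.ofReal (r ^ 2) * A (r ^ 2)) *
        ∫⁻ φ in Set.Ioo 0 Real.pi, ENNReal.ofReal (Real.sin φ) * B (Real.cos φ) := by
  have h0 : ∀ x : E3, A (‖x‖ ^ 2) * B (x 0 / ‖x‖) =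
      A ((x 0) ^ 2 + ((x 1) ^ 2 + (x 2) ^ 2)) *
        B (x 0 / √((x 0) ^ 2 + ((x 1) ^ 2 + (x 2) ^ 2))) := by
    intro x
    rw [← add_assoc, ← norm_sq_eq_coord, Real.sqrt_sq (norm_nonneg _)]
  simp_rw [h0]
  rw [measurePreserving_coords.lintegral_comp (f := fun p : ℝ × ℝ × ℝ =>
    A (p.1 ^ 2 + (p.2.1 ^ 2 + p.2.2 ^ 2)) * B (p.1 / √(p.1 ^ 2 + (p.2.1 ^ 2 + p.2.2 ^ 2))))
    (by fun_prop), Measure.volume_eq_prod, lintegral_prod _ (by fun_prop)]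
  have h1 : ∀ z : ℝ, ∫⁻ q : ℝ × ℝ, A (z ^ 2 + (q.1 ^ 2 + q.2 ^ 2)) *
      B (z / √(z ^ 2 + (q.1 ^ 2 + q.2 ^ 2))) = ENNReal.ofReal (2 * Real.pi) *
      ∫⁻ ρ : ℝ, (if 0 < ρ then ENNReal.ofReal ρ *
        (A (z ^ 2 + ρ ^ 2) * B (z / √(z ^ 2 + ρ ^ 2))) else 0) := by
    intro z
    rw [lintegral_radial_two (g := fun q => A (z ^ 2 + q) * B (z / √(z ^ 2 + q))) (by fun_prop),
      ← lintegral_indicator measurableSet_Ioi]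
    rfl
  have hm : Measurable fun p : ℝ × ℝ => (if 0 < p.2 then ENNReal.ofReal p.2 *
      (A (p.1 ^ 2 + p.2 ^ 2) * B (p.1 / √(p.1 ^ 2 + p.2 ^ 2))) else 0) :=
    Measurable.ite (measurableSet_lt measurable_const measurable_snd) (by fun_prop)
      measurable_const
  simp only
  simp_rw [h1]
  rw [lintegral_const_mul _ hm.lintegral_prod_right', mul_assoc, ← lintegral_half_plane hA hB,
    Measure.volume_eq_prod, lintegral_prod _ hm.aemeasurable]

/-- `∫₀^π sin φ (r² + s² - 2 r s cos φ)^{-1/2} dφ = 2 / max r s`. -/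
lemma lintegral_sin_mul_inv_sqrt {r s : ℝ} (hr : 0 < r) (hs : 0 < s) :
    ∫⁻ φ in Set.Ioo 0 Real.pi, ENNReal.ofReal (Real.sin φ) *
      (ENNReal.ofReal √(r ^ 2 + s ^ 2 - 2 * r * s * Real.cos φ))⁻¹ =
      ENNReal.ofReal (2 / max r s) := by
  have hp := Real.pi_pos
  have hpos : ∀ φ ∈ Set.Ioo 0 Real.pi, 0 < r ^ 2 + s ^ 2 - 2 * r * s * Real.cos φ := by
    intro φ hφ
    have hc : Real.cos φ < 1 := by
      have := Real.strictAntiOn_cos ⟨le_rfl, hp.le⟩ ⟨hφ.1.le, hφ.2.le⟩ hφ.1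
      rwa [Real.cos_zero] at this
    nlinarith [sq_nonneg (r - s), mul_pos hr hs]
  have hd : ∀ φ ∈ Set.Ioo 0 Real.pi, HasDerivAt
      (fun φ => √(r ^ 2 + s ^ 2 - 2 * r * s * Real.cos φ) / (r * s))
      (Real.sin φ * (√(r ^ 2 + s ^ 2 - 2 * r * s * Real.cos φ))⁻¹) φ := by
    intro φ hφ
    have h1 := ((((Real.hasDerivAt_cos φ).const_mul (2 * r * s)).const_sub
      (r ^ 2 + s ^ 2)).sqrt (hpos φ hφ).ne').div_const (r * s)
    refine h1.congr_deriv ?_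
    have := Real.sqrt_pos.2 (hpos φ hφ)
    field_simp
  have hcont : ContinuousOn (fun φ => √(r ^ 2 + s ^ 2 - 2 * r * s * Real.cos φ) / (r * s))
      (Set.Icc 0 Real.pi) := by fun_prop
  have hnn : ∀ φ ∈ Set.Ioo 0 Real.pi,
      0 ≤ Real.sin φ * (√(r ^ 2 + s ^ 2 - 2 * r * s * Real.cos φ))⁻¹ := fun φ hφ =>
    mul_nonneg (Real.sin_nonneg_of_nonneg_of_le_pi hφ.1.le hφ.2.le)
      (inv_nonneg.2 (Real.sqrt_nonneg _))
  have hi := intervalIntegral.integrableOn_deriv_of_nonneg hcont hd hnn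
  have hI := intervalIntegral.integral_eq_sub_of_hasDerivAt_of_le hp.le hcont hd
    ((intervalIntegrable_iff_integrableOn_Ioc_of_le hp.le).2 hi)
  have h1 : ∫⁻ φ in Set.Ioo 0 Real.pi, ENNReal.ofReal (Real.sin φ) *
      (ENNReal.ofReal √(r ^ 2 + s ^ 2 - 2 * r * s * Real.cos φ))⁻¹ =
      ∫⁻ φ in Set.Ioo 0 Real.pi, ENNReal.ofReal
        (Real.sin φ * (√(r ^ 2 + s ^ 2 - 2 * r * s * Real.cos φ))⁻¹) := by
    refine setLIntegral_congr_fun measurableSet_Ioo fun φ hφ => ?_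
    rw [ENNReal.ofReal_mul (Real.sin_nonneg_of_nonneg_of_le_pi hφ.1.le hφ.2.le),
      ENNReal.ofReal_inv_of_pos (Real.sqrt_pos.2 (hpos φ hφ))]
  rw [h1, setLIntegral_congr Ioo_ae_eq_Ioc, ← ofReal_integral_eq_lintegral_ofReal hi ?_,
    ← intervalIntegral.integral_of_le hp.le, hI]
  · congr 1
    rw [Real.cos_pi, Real.cos_zero,
      show r ^ 2 + s ^ 2 - 2 * r * s * -1 = (r + s) ^ 2 by ring,
      show r ^ 2 + s ^ 2 - 2 * r * s * 1 = (r - s) ^ 2 by ring, Real.sqrt_sq (by positivity),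
      Real.sqrt_sq_eq_abs]
    rcases le_total r s with h | h
    · rw [max_eq_right h, abs_of_nonpos (by linarith)]; field_simp; ring
    · rw [max_eq_left h, abs_of_nonneg (by linarith)]; field_simp; ring
  · rw [← restrict_Ioo_eq_restrict_Ioc]
    exact (ae_restrict_iff' measurableSet_Ioo).2 (ae_of_all _ hnn)

/-- The uniform probability measure on the sphere of radius `r` about the origin, obtained by
projecting the standard Gaussian. -/
noncomputable def sphereMeasure (r : ℝ) : Measure E3 :=
  (gauss 0 1).map fun x => (r / ‖x‖) • x

instance (r : ℝ) : IsProbabilityMeasure (sphereMeasure r) := by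
  have := isProbabilityMeasure_gauss 0 one_pos
  exact Measure.isProbabilityMeasure_map (by fun_prop)

lemma lintegral_sphereMeasure (r : ℝ) {f : E3 → ℝ≥0∞} (hf : Measurable f) :
    ∫⁻ x, f x ∂sphereMeasure r = ∫⁻ x, f ((r / ‖x‖) • x) ∂gauss 0 1 :=
  lintegral_map hf (by fun_prop)

lemma ae_norm_sphereMeasure {r : ℝ} (hr : 0 < r) : ∀ᵐ x ∂sphereMeasure r, ‖x‖ = r := by
  rw [sphereMeasure, ae_map_iff (by fun_prop) (measurableSet_eq_fun (by fun_prop) (by fun_prop))]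
  filter_upwards [ae_gauss_ne 0 0 1] with x hx
  have := norm_pos_iff.2 hx
  rw [norm_smul, Real.norm_of_nonneg (by positivity)]
  field_simp

lemma lintegral_gauss_zonal {B : ℝ → ℝ≥0∞} (hB : Measurable B) :
    ∫⁻ x : E3, B (x 0 / ‖x‖) ∂gauss 0 1 =
      2⁻¹ * ∫⁻ φ in Set.Ioo 0 Real.pi, ENNReal.ofReal (Real.sin φ) * B (Real.cos φ) := by
  -- the radial integral `K` need not be computed: the case `B = 1` determines it
  have key : ∃ K : ℝ≥0∞, ∀ B : ℝ → ℝ≥0∞, Measurable B →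
      ∫⁻ x : E3, B (x 0 / ‖x‖) ∂gauss 0 1 =
        K * ∫⁻ φ in Set.Ioo 0 Real.pi, ENNReal.ofReal (Real.sin φ) * B (Real.cos φ) := by
    refine ⟨ENNReal.ofReal (2 * Real.pi) * ∫⁻ r in Set.Ioi (0 : ℝ), ENNReal.ofReal (r ^ 2) *
      ENNReal.ofReal ((√(2 * Real.pi * 1) ^ 3)⁻¹ * Real.exp (-r ^ 2 / (2 * 1))),
      fun B hB => ?_⟩
    rw [lintegral_gauss _ _ (by fun_prop)]
    simp only [sub_zero, heat]
    exact lintegral_zonal (A := fun q => ENNReal.ofReal ((√(2 * Real.pi * 1) ^ 3)⁻¹ *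
      Real.exp (-q / (2 * 1)))) (by fun_prop) hB
  obtain ⟨K, hK⟩ := key
  have h1 := hK (fun _ => 1) measurable_const
  have hs : ∫⁻ φ in Set.Ioo 0 Real.pi, ENNReal.ofReal (Real.sin φ) * 1 = 2 := by
    simp only [mul_one]
    have hi : IntegrableOn Real.sin (Set.Ioc 0 Real.pi) :=
      Real.continuous_sin.integrableOn_Ioc
    rw [setLIntegral_congr Ioo_ae_eq_Ioc, ← ofReal_integral_eq_lintegral_ofReal hi
      ((ae_restrict_iff' measurableSet_Ioc).2 (ae_of_all _ fun φ hφ =>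
        Real.sin_nonneg_of_nonneg_of_le_pi hφ.1.le hφ.2)),
      ← intervalIntegral.integral_of_le Real.pi_pos.le, integral_sin, Real.cos_zero, Real.cos_pi]
    norm_num
  have := isProbabilityMeasure_gauss 0 one_pos
  rw [hs] at h1
  simp only [lintegral_const, measure_univ, mul_one] at h1
  rw [hK B hB, ENNReal.eq_inv_of_mul_eq_one_left h1.symm]

/-- Newton's theorem. -/
lemma lintegral_sphereMeasure_inv {r : ℝ} (hr : 0 < r) {z : E3} (hz : z ≠ 0) :
    ∫⁻ y, ‖y - z‖ₑ⁻¹ ∂sphereMeasure r = ENNReal.ofReal (1 / max r ‖z‖) := by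
  have hs : 0 < ‖z‖ := norm_pos_iff.2 hz
  set s := ‖z‖ with hsdef
  set e : E3 := EuclideanSpace.single 0 s with he
  have hes : ‖e‖ = s := by simp [he, abs_of_pos hs]
  -- a reflection moves `z` to the first axis
  obtain ⟨T, hT⟩ : ∃ T : E3 ≃ₗᵢ[ℝ] E3, T e = z :=
    ⟨_, Submodule.reflection_sub (v := e) (w := z) (by rw [hes])⟩
  rw [lintegral_sphereMeasure r (by fun_prop), lintegral_gauss _ _ (by fun_prop),
    ← T.measurePreserving.lintegral_comp (by unfold heat; fun_prop)]
  have h1 : ∀ᵐ x : E3, ENNReal.ofReal (heat 1 (T x - 0)) * ‖(r / ‖T x‖) • T x - z‖ₑ⁻¹ =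
      ENNReal.ofReal (heat 1 (x - 0)) *
        (ENNReal.ofReal √(r ^ 2 + s ^ 2 - 2 * r * s * (x 0 / ‖x‖)))⁻¹ := by
    have h0 : ∀ᵐ x : E3, x ≠ 0 := by rw [ae_iff]; simp
    filter_upwards [h0] with x hx
    have hxn : 0 < ‖x‖ := norm_pos_iff.2 hx
    have e1 : ‖(r / ‖T x‖) • T x - z‖ = √(r ^ 2 + s ^ 2 - 2 * r * s * (x 0 / ‖x‖)) := by
      rw [T.norm_map, ← hT, ← map_smul, ← map_sub, T.norm_map,
        ← Real.sqrt_sq (norm_nonneg ((r / ‖x‖) • x - e))]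
      congr 1
      rw [norm_sub_sq_eq_dot, hes, norm_smul, Real.norm_of_nonneg (by positivity),
        div_mul_cancel₀ _ hxn.ne']
      simp [dot, he]
      ring
    rw [sub_zero, sub_zero, ← ofReal_norm, e1]
    simp only [heat, T.norm_map]
  rw [lintegral_congr_ae h1, ← lintegral_gauss 0 1 (f := fun x : E3 =>
    (ENNReal.ofReal √(r ^ 2 + s ^ 2 - 2 * r * s * (x 0 / ‖x‖)))⁻¹) (by fun_prop),
    lintegral_gauss_zonal (B := fun c => (ENNReal.ofReal √(r ^ 2 + s ^ 2 - 2 * r * s * c))⁻¹)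
      (by fun_prop), lintegral_sin_mul_inv_sqrt hr hs]
  rw [show (2⁻¹ : ℝ≥0∞) = ENNReal.ofReal (2⁻¹) by
    rw [ENNReal.ofReal_inv_of_pos two_pos, ENNReal.ofReal_ofNat],
    ← ENNReal.ofReal_mul (by norm_num)]
  congr 1
  ring

lemma energy_sphereMeasure {r s : ℝ} (hr : 0 < r) (hs : 0 < s) :
    energy (sphereMeasure r) (sphereMeasure s) = ENNReal.ofReal (r ^ 2 / max s r) := by
  have h : ∀ᵐ x ∂sphereMeasure r, ‖x‖ₑ ^ 2 * ∫⁻ y, ‖y - x‖ₑ⁻¹ ∂sphereMeasure s =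
      ENNReal.ofReal (r ^ 2 / max s r) := by
    filter_upwards [ae_norm_sphereMeasure hr] with x hx
    rw [lintegral_sphereMeasure_inv hs (norm_pos_iff.1 (hx ▸ hr)), ← ofReal_norm, hx,
      ← ENNReal.ofReal_pow hr.le, ← ENNReal.ofReal_mul (by positivity)]
    congr 1; ring
  rw [energy, lintegral_congr_ae h]
  simp

lemma firstMoment_sphereMeasure {r : ℝ} (hr : 0 < r) :
    firstMoment (sphereMeasure r) = ENNReal.ofReal r := by
  have h : ∀ᵐ x ∂sphereMeasure r, ‖x‖ₑ = ENNReal.ofReal r := by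
    filter_upwards [ae_norm_sphereMeasure hr] with x hx
    rw [← ofReal_norm, hx]
  rw [firstMoment, lintegral_congr_ae h]
  simp

/-! ### The upper bound on `β` -/

/-- The variational inequality for a mixture of uniform measures on spheres with equal weights. -/
lemma betaENN_mul_shells_le {n : ℕ} (hn : 0 < n) (r : Fin n → ℝ) (hr : ∀ i, 0 < r i) :
    betaENN * ENNReal.ofReal (n * ∑ i, r i) ≤
      ENNReal.ofReal (∑ i, ∑ j, r i ^ 2 / max (r j) (r i)) := by
  have hN0 : (n : ℝ≥0∞) ≠ 0 := Nat.cast_ne_zero.2 (by omega)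
  have hNt : (n : ℝ≥0∞) ≠ ∞ := ENNReal.natCast_ne_top n
  have hNN : (n : ℝ≥0∞) * (n : ℝ≥0∞)⁻¹ = 1 := ENNReal.mul_inv_cancel hN0 hNt
  set ρ : Measure E3 := ∑ i, (n : ℝ≥0∞)⁻¹ • sphereMeasure (r i) with hρ
  have hρp : IsProbabilityMeasure ρ := ⟨by
    rw [hρ, Measure.finsetSum_apply]
    simp [hNN]⟩
  have hS : 0 < ∑ i, r i := Finset.sum_pos (fun i _ => hr i) ⟨⟨0, hn⟩, Finset.mem_univ _⟩
  have hM : firstMoment ρ = (n : ℝ≥0∞)⁻¹ * ENNReal.ofReal (∑ i, r i) := by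
    rw [hρ, firstMoment_smul_sum, ENNReal.ofReal_sum_of_nonneg fun i _ => (hr i).le,
      Finset.mul_sum]
    exact Finset.sum_congr rfl fun i _ => by rw [firstMoment_sphereMeasure (hr i)]
  have hMt : firstMoment ρ ≠ ∞ := by
    rw [hM]; exact ENNReal.mul_ne_top (ENNReal.inv_ne_top.2 hN0) ENNReal.ofReal_ne_top
  have hM0 : firstMoment ρ ≠ 0 := by
    rw [hM]; exact mul_ne_zero (ENNReal.inv_ne_zero.2 hNt) (ENNReal.ofReal_pos.2 hS).ne'
  have hE : energy ρ ρ = (n : ℝ≥0∞)⁻¹ * (n : ℝ≥0∞)⁻¹ *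
      ENNReal.ofReal (∑ i, ∑ j, r i ^ 2 / max (r j) (r i)) := by
    have hnn : ∀ i j, 0 ≤ r i ^ 2 / max (r j) (r i) := fun i j =>
      div_nonneg (sq_nonneg _) ((hr i).le.trans (le_max_right _ _))
    rw [hρ, energy_smul_sum, ENNReal.ofReal_sum_of_nonneg fun i _ =>
      Finset.sum_nonneg fun j _ => hnn i j, Finset.mul_sum]
    refine Finset.sum_congr rfl fun i _ => ?_
    rw [ENNReal.ofReal_sum_of_nonneg fun j _ => hnn i j, Finset.mul_sum]
    exact Finset.sum_congr rfl fun j _ => by rw [energy_sphereMeasure (hr i) (hr j)]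
  have h := betaENN_mul_le ρ hM0 hMt
  rw [hM, hE] at h
  rw [ENNReal.ofReal_mul (Nat.cast_nonneg n), ENNReal.ofReal_natCast]
  calc _ = (n : ℝ≥0∞) * ((n : ℝ≥0∞) * (n : ℝ≥0∞)⁻¹) *
        (betaENN * ENNReal.ofReal (∑ i, r i)) := by rw [hNN]; ring
    _ = (n : ℝ≥0∞) * n * (betaENN * ((n : ℝ≥0∞)⁻¹ * ENNReal.ofReal (∑ i, r i))) := by ring
    _ ≤ (n : ℝ≥0∞) * n * _ := mul_le_mul' le_rfl h
    _ = ((n : ℝ≥0∞) * (n : ℝ≥0∞)⁻¹) * ((n : ℝ≥0∞) * (n : ℝ≥0∞)⁻¹) *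
        ENNReal.ofReal (∑ i, ∑ j, r i ^ 2 / max (r j) (r i)) := by ring
    _ = _ := by rw [hNN, one_mul, one_mul]

/-- Radii of the spheres in the trial measure: integers close to a numerical minimizer of the
quotient among the mixtures of 32 spheres with equal weights. -/
def shellRadius : Fin 32 → ℕ :=
  ![10, 11, 11, 12, 13, 14, 14, 15, 16, 17, 18, 19, 20, 22, 23, 24, 26, 27, 29, 31, 33, 35, 38,
    41, 44, 48, 52, 57, 63, 71, 82, 97]

lemma shellRadius_pos : ∀ i, 0 < shellRadius i := by decide

lemma shell_energy_lt :
    (∑ i, ∑ j, (shellRadius i : ℚ) ^ 2 / max (shellRadius j : ℚ) (shellRadius i : ℚ)) <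
      8705 / 10000 * (32 * ∑ i, (shellRadius i : ℚ)) := by
  decide +kernel

theorem betaENN_lt : betaENN < ENNReal.ofReal 0.8705 := by
  have h := betaENN_mul_shells_le (n := 32) (by norm_num) (fun i => (shellRadius i : ℝ))
    fun i => by exact_mod_cast shellRadius_pos i
  have hq : (∑ i, ∑ j, (shellRadius i : ℝ) ^ 2 / max (shellRadius j : ℝ) (shellRadius i : ℝ)) <
      8705 / 10000 * (32 * ∑ i, (shellRadius i : ℝ)) := by
    have h := (Rat.cast_lt (K := ℝ)).2 shell_energy_lt
    push_cast at h
    exact h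
  have hS : 0 < ∑ i, (shellRadius i : ℝ) :=
    Finset.sum_pos (fun i _ => by exact_mod_cast shellRadius_pos i) ⟨0, Finset.mem_univ _⟩
  by_contra hlt
  refine absurd ((mul_le_mul' (not_lt.1 hlt) le_rfl).trans h) (not_le.2 ?_)
  rw [← ENNReal.ofReal_mul (by norm_num)]
  refine (ENNReal.ofReal_lt_ofReal_iff (by push_cast; positivity)).2 (hq.trans_le (le_of_eq ?_))
  norm_num

end ClassicalParticles

theorem mainTheorem3 :
    MonotoneOn ClassicalParticles.alpha (Set.Ici 2) ∧
    (∀ N : ℕ, 2 ≤ N →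
      ClassicalParticles.alpha N ≤ ClassicalParticles.beta ∧
      (N : ℝ) / ((N : ℝ) - 1) *
          (ClassicalParticles.beta -
            3 * (ClassicalParticles.beta / 6) ^ ((1 : ℝ) / 3) * (N : ℝ) ^ (-((2 : ℝ) / 3)))
        ≤ ClassicalParticles.alpha N) ∧
    Tendsto ClassicalParticles.alpha atTop (𝓝 ClassicalParticles.beta) ∧
    ClassicalParticles.betaENN ≠ ∞ ∧
    ClassicalParticles.beta ∈ Set.Ico (0.8218 : ℝ) 0.8705 := by
  have hβ : ClassicalParticles.betaENN ≠ ∞ :=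
    (ClassicalParticles.betaENN_lt.trans ENNReal.ofReal_lt_top).ne
  have hlow := ClassicalParticles.le_beta hβ
  have hβ0 : 0 < ClassicalParticles.beta := lt_of_lt_of_le (by norm_num) hlow
  refine ⟨ClassicalParticles.alpha_monotoneOn, fun N hN => ⟨ClassicalParticles.alpha_le_beta hN hβ,
    ClassicalParticles.le_alpha_of_beta hβ hβ0 hN⟩,
    ClassicalParticles.tendsto_alpha hβ hβ0, hβ, hlow, ?_⟩
  exact (ENNReal.lt_ofReal_iff_toReal_lt hβ).1 ClassicalParticles.betaENN_lt
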